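/- Let $H$ be a real or complex Hilbert space, and let $G=\prod_{i=1}^{d}s_i\mathbb Z\times\prod_{k=1}^{e}\mathbb Z_{n_k}$ with $d\ge 1$, $e\ge 0$, $s_i>0$, $n_k\ge 1$. For $g=(s_1m_1,\dots,s_dm_d,z_1,\dots,z_e)\in G$ put $|g|=\sup\{|s_1m_1|,\dots,|s_dm_d|,\delta(z_1),\dots,\delta(z_e)\}$, where $\delta(z)=0$ if $z=0$ and $\delta(z)=1$ otherwise. For $j\in G$ and an integer $N\ge 0$ let $S_N(j)=\{k\in G:|k-j|\le N/2\}$. For an index set $I$ and a map $a:I\to G$ let $I_N(j)=a^{-1}(S_N(j))$ and $$D^-(I,a)=\liminf_{N\to\infty}\inf_{j\in G}\frac{|I_N(j)|}{|S_N(j)|},\qquad D^+(I,a)=\limsup_{N\to\infty}\sup_{j\in G}\frac{|I_N(j)|}{|S_N(j)|}.$$ For $J\subset I$ write $D^\pm(J,a)=D^\pm(J,a|_J)$. A family $\mathcal F=\{f_i\}_{i\in I}$ in a closed subspace $K$ of $H$ is a frame for $K$ with frame bounds $A,B>0$ if $A\|x\|^2\le\sum_{i\in I}|\langle x,f_i\rangle|^2\le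 B\|x\|^2$ for all $x\in K$. If $\mathcal F$ is a frame for $H$, its frame operator is $Sx=\sum_i\langle x,f_i\rangle f_i$, its canonical dual frame is $\tilde f_i=S^{-1}f_i$, and (relative to $a$) $$\mathcal M^+(\mathcal F)=\limsup_{N\to\infty}\sup_{j\in G}\frac1{|I_N(j)|}\sum_{i\in I_N(j)}\langle f_i,\tilde f_i\rangle.$$ For a frame $\mathcal E=\{e_j\}_{j\in G}$ for $H$, $\mathcal M^+(\mathcal E)$ is defined in the same way with the identity map $G\to G$ in place of $a$. Let $\mathcal F=\{f_i\}_{i\in I}$ and $\mathcal E=\{e_j\}_{j\in G}$ be frames for $H$, let $A,B$ be frame bounds for $\mathcal F$, and let $a:I\to G$ be a map. Assume: (a) $0<D^-(I,a)\le D^+(I,a)<\infty$; (b) $(\mathcal F,a)$ is $\ell^1$-localized with respect to its canonical dual frame, i.e. there is $r\in\ell^1(G)$ with $|\langle f_i,\tilde f_j\rangle|\le r_{a(i)-a(j)}$ for all $i,j\in I$; (c) $(\mathcal F,a,\mathcal E)$ has $\ell^2$-column decay and $\ell^2$-row decay, i.e. for every $\varepsilon>0$ there is an integer $N>0$ with $\sum_{i\in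 I\setminus I_N(j)}|\langle f_i,e_j\rangle|^2<\varepsilon$ for all $j\in G$, and for every $\varepsilon>0$ there is an integer $N>0$ with $\sum_{j\in G\setminus S_N(a(i))}|\langle f_i,e_j\rangle|^2<\varepsilon$ for all $i\in I$; (d) $\mathcal M^+(\mathcal E)<D^-(I,a)$. Then $\mathcal M^+(\mathcal F)<1$, and there is a subset $J\subset I$ such that $D^+(J,a)=D^-(J,a)>0$ and $\{f_i\}_{i\in I\setminus J}$ is a frame for $\overline{\mathrm{span}}(\mathcal F)$ $(=H)$. Moreover, if $\mathcal M^+(\mathcal F)<\alpha<1$ and $J_\alpha=\{i\in I:\langle f_i,\tilde f_i\rangle\le\alpha\}$, then for each $0<\varepsilon<1-\alpha$ there is a subset $J\subset J_\alpha$ such that $D^+(J,a)=D^-(J,a)>0$ and $\{f_i\}_{i\in I\setminus J}$ is a frame for $\overline{\mathrm{span}}(\mathcal F)$ with frame bounds $A(1-\alpha-\varepsilon)$, $B$. Finally, if (a)--(c) hold and $\mathcal E$ is a Riesz basis for $H$ (the image of an orthonormal basis under a continuous invertible linear map), then (d) holds if and only if $D^-(I,a)>1$. -/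

import Mathlib

open Filter
open scoped ENNReal

noncomputable section

namespace FrameDensity

/-- The reference group `G = ∏ᵢ sᵢ ℤ × ∏ₖ ℤ_{nₖ}`.  An element `sᵢ m` of `sᵢ ℤ` is represented by
the integer `m`; the step sizes `sᵢ > 0` enter through the metric, see `gNorm`. -/
abbrev RefGroup (d e : ℕ) (n : Fin e → ℕ) : Type :=
  (Fin d → ℤ) × ((k : Fin e) → ZMod (n k))

section Group

variable {d e : ℕ} {n : Fin e → ℕ}

/-- `|g| = sup {|s₁ m₁|, …, |s_d m_d|, δ(z₁), …, δ(z_e)}` for `g = (s₁ m₁, …, s_d m_d, z₁, …, z_e)`,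
where `δ(z) = 0` if `z = 0` and `δ(z) = 1` otherwise.  The metric of `G` is `|g - h|`. -/
def gNorm (s : Fin d → ℝ) (g : RefGroup d e n) : ℝ :=
  max (⨆ i, |s i * (g.1 i : ℝ)|) (⨆ k, if g.2 k = 0 then (0 : ℝ) else 1)

/-- The box `S_N(j) = {k ∈ G : |k - j| ≤ N / 2}`. -/
def box (s : Fin d → ℝ) (N : ℕ) (j : RefGroup d e n) : Set (RefGroup d e n) :=
  {k | gNorm s (k - j) ≤ (N : ℝ) / 2}

/-- `I_N(j) = a⁻¹(S_N(j))`. -/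
def preBox {I : Type*} (s : Fin d → ℝ) (a : I → RefGroup d e n) (N : ℕ) (j : RefGroup d e n) :
    Set I :=
  a ⁻¹' box s N j

/-- The lower density `D⁻(I, a)`. -/
def lowerDensity {I : Type*} (s : Fin d → ℝ) (a : I → RefGroup d e n) : ℝ≥0∞ :=
  liminf (fun N : ℕ => ⨅ j : RefGroup d e n,
    ((preBox s a N j).encard : ℝ≥0∞) / ((box s N j).encard : ℝ≥0∞)) atTop

/-- The upper density `D⁺(I, a)`. -/
def upperDensity {I : Type*} (s : Fin d → ℝ) (a : I → RefGroup d e n) : ℝ≥0∞ :=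
  limsup (fun N : ℕ => ⨆ j : RefGroup d e n,
    ((preBox s a N j).encard : ℝ≥0∞) / ((box s N j).encard : ℝ≥0∞)) atTop

end Group

section Frames

variable (𝕜 : Type*) [RCLike 𝕜] {H : Type*} [NormedAddCommGroup H] [InnerProductSpace 𝕜 H]
  {I : Type*}

/-- `f` is a frame for the subspace `K` with frame bounds `A`, `B`: the `f i` lie in `K` and
`A ‖x‖² ≤ ∑ᵢ |⟨x, fᵢ⟩|² ≤ B ‖x‖²` for all `x ∈ K` (in particular the series converges). -/
def IsFrameForWith (K : Submodule 𝕜 H) (f : I → H) (A B : ℝ) : Prop :=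
  0 < A ∧ 0 < B ∧ (∀ i, f i ∈ K) ∧
    ∀ x ∈ K, Summable (fun i => ‖inner 𝕜 (f i) x‖ ^ 2) ∧
      A * ‖x‖ ^ 2 ≤ ∑' i, ‖inner 𝕜 (f i) x‖ ^ 2 ∧
      ∑' i, ‖inner 𝕜 (f i) x‖ ^ 2 ≤ B * ‖x‖ ^ 2

/-- `f` is a frame for the subspace `K`. -/
def IsFrameFor (K : Submodule 𝕜 H) (f : I → H) : Prop :=
  ∃ A B : ℝ, IsFrameForWith 𝕜 K f A B

/-- The closed linear span of a family. -/
def closedSpan (f : I → H) : Submodule 𝕜 H :=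
  (Submodule.span 𝕜 (Set.range f)).topologicalClosure

/-- The frame operator `S x = ∑ᵢ ⟨x, fᵢ⟩ fᵢ`; Mathlib's inner product is conjugate-linear in its
first argument, so `⟨x, fᵢ⟩` is `inner 𝕜 (f i) x`. -/
def frameOperator (f : I → H) (x : H) : H :=
  ∑' i, inner 𝕜 (f i) x • f i

/-- The canonical dual `S⁻¹ fᵢ` of a frame for `H`.  For such a frame `S` is a bijection of `H`,
and `Function.invFun` is its inverse. -/
def canonicalDual (f : I → H) (i : I) : H :=
  Function.invFun (frameOperator 𝕜 f) (f i)

/-- The (real) number `⟨fᵢ, S⁻¹ fᵢ⟩`, which lies in `[0, 1]` if `f` is a frame for `H`. -/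
def dualDiag (f : I → H) (i : I) : ℝ :=
  RCLike.re (inner 𝕜 (canonicalDual 𝕜 f i) (f i))

/-- A Riesz basis of `H`: the image of an orthonormal basis under a continuous linear bijection
(whose inverse is automatically continuous if `H` is complete). -/
def IsRieszBasis (f : I → H) : Prop :=
  ∃ (b : HilbertBasis I 𝕜 H) (T : H ≃L[𝕜] H), ∀ i, f i = T (b i)

variable {d e : ℕ} {n : Fin e → ℕ}

/-- The upper measure `M⁺(F) = limsup_N sup_j |I_N(j)|⁻¹ ∑_{i ∈ I_N(j)} ⟨fᵢ, S⁻¹ fᵢ⟩` of a frame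
`F` for `H`.  The terms are nonnegative, so the sum is taken in `[0, ∞]`. -/
def upperMeasure (s : Fin d → ℝ) (a : I → RefGroup d e n) (f : I → H) : ℝ≥0∞ :=
  limsup (fun N : ℕ => ⨆ j : RefGroup d e n,
    (∑' i : preBox s a N j, ENNReal.ofReal (dualDiag 𝕜 f i)) /
      ((preBox s a N j).encard : ℝ≥0∞)) atTop

/-- `(F, a)` is `ℓ¹`-localized with respect to its canonical dual frame. -/
def IsL1LocalizedDual (a : I → RefGroup d e n) (f : I → H) : Prop :=
  ∃ r : RefGroup d e n → ℝ, Summable r ∧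
    ∀ i j : I, ‖inner 𝕜 (canonicalDual 𝕜 f j) (f i)‖ ≤ r (a i - a j)

/-- `(F, a, E)` has `ℓ²`-column decay. -/
def HasL2ColumnDecay (s : Fin d → ℝ) (a : I → RefGroup d e n) (f : I → H)
    (E : RefGroup d e n → H) : Prop :=
  ∀ ε : ℝ, 0 < ε → ∃ N : ℕ, 0 < N ∧ ∀ j : RefGroup d e n,
    ∑' i : ((preBox s a N j)ᶜ : Set I), ‖inner 𝕜 (E j) (f i)‖ₑ ^ 2 < ENNReal.ofReal ε

/-- `(F, a, E)` has `ℓ²`-row decay. -/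
def HasL2RowDecay (s : Fin d → ℝ) (a : I → RefGroup d e n) (f : I → H)
    (E : RefGroup d e n → H) : Prop :=
  ∀ ε : ℝ, 0 < ε → ∃ N : ℕ, 0 < N ∧ ∀ i : I,
    ∑' j : ((box s N (a i))ᶜ : Set (RefGroup d e n)), ‖inner 𝕜 (E j) (f i)‖ₑ ^ 2
      < ENNReal.ofReal ε

end Frames

end FrameDensity

end

/-!
A single matrix controls both measures: the array `⟨fᵢ, eₓ⟩ ⟨ẽₓ, f̃ᵢ⟩` has row sums `⟨fᵢ, f̃ᵢ⟩` and
column sums conjugate to `⟨eₓ, ẽₓ⟩`.  By the decay hypotheses and the Cauchy–Schwarz inequality the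
rows and columns that meet a box away from its boundary layer have almost all their mass inside it,
so the sums of `⟨fᵢ, f̃ᵢ⟩` and of `⟨eₓ, ẽₓ⟩` over the box differ by `o(|S_N|)`, uniformly in its
centre.  Dividing by `|I_N| ≳ D⁻(I, a) |S_N|` gives `M⁺(F) ≤ M⁺(E) / D⁻(I, a) < 1`.

If `M⁺(F) < α`, every sufficiently large box contains the position of an index with
`⟨fᵢ, f̃ᵢ⟩ ≤ α`.  Choosing one such index near each point of a coarse lattice yields a set `J`
whose density exists, is positive, and whose positions are as far apart as desired.  By
`ℓ¹`-localization the rows of `(⟨fᵢ, f̃ⱼ⟩)` over `J` then have absolute sums at most `α + ε`.  Since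
`x = ∑ᵢ ⟨x, f̃ᵢ⟩ fᵢ`, this Schur-type bound yields
`∑_{i ∈ J} |⟨x, fᵢ⟩|² ≤ (α + ε) ∑_{i ∈ I} |⟨x, fᵢ⟩|²`, so the remaining elements keep the lower
frame bound `A (1 - α - ε)`.
-/

namespace FrameDensity

open Topology

theorem le_mul_sq_of_le_mul_of_sq_le {c p q r : ℝ} (hc : 0 ≤ c) (hp : 0 ≤ p) (hpqr : p ≤ q * r)
    (hr : r ^ 2 ≤ c * p) : p ≤ c * q ^ 2 := by
  rcases hp.eq_or_lt with rfl | hpos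
  · positivity
  · refine le_of_mul_le_mul_left ?_ hpos
    calc p * p ≤ (q * r) * (q * r) := mul_self_le_mul_self hp hpqr
      _ = q ^ 2 * r ^ 2 := by ring
      _ ≤ q ^ 2 * (c * p) := by gcongr
      _ = p * (c * q ^ 2) := by ring

section Gram

variable {𝕜 V I : Type*} [RCLike 𝕜] [SeminormedAddCommGroup V] [InnerProductSpace 𝕜 V]

theorem norm_sq_sum_smul_le_of_gram {F : Finset I} {v : I → V} {θ : ℝ}
    (hθ : ∀ i ∈ F, ∑ j ∈ F, ‖inner 𝕜 (v i) (v j)‖ ≤ θ) (c : I → 𝕜) :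
    ‖∑ i ∈ F, c i • v i‖ ^ 2 ≤ θ * ∑ i ∈ F, ‖c i‖ ^ 2 := by
  set g : I → I → ℝ := fun i j => ‖inner 𝕜 (v i) (v j)‖ with hg
  have hsymm : ∑ i ∈ F, ∑ j ∈ F, g i j * ‖c j‖ ^ 2 = ∑ i ∈ F, ∑ j ∈ F, g i j * ‖c i‖ ^ 2 := by
    rw [Finset.sum_comm]
    simp only [hg, norm_inner_symm]
  calc ‖∑ i ∈ F, c i • v i‖ ^ 2
      = ‖inner 𝕜 (∑ i ∈ F, c i • v i) (∑ i ∈ F, c i • v i)‖ := by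
        rw [inner_self_eq_norm_sq_to_K, norm_pow, RCLike.norm_ofReal, abs_norm]
    _ ≤ ∑ i ∈ F, ∑ j ∈ F, ‖c i‖ * (‖c j‖ * g i j) := by
        simp only [sum_inner, inner_sum, inner_smul_left, inner_smul_right]
        refine (norm_sum_le _ _).trans (Finset.sum_le_sum fun i _ => ?_)
        rw [Finset.mul_sum]
        refine (norm_sum_le _ _).trans_eq (Finset.sum_congr rfl fun j _ => ?_)
        rw [norm_mul, norm_mul, RCLike.norm_conj, norm_inner_symm]
    _ ≤ ∑ i ∈ F, ∑ j ∈ F, (g i j * ‖c i‖ ^ 2 + g i j * ‖c j‖ ^ 2) / 2 := by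
        gcongr with i _ j _
        nlinarith [mul_nonneg (norm_nonneg (inner 𝕜 (v i) (v j))) (sq_nonneg (‖c i‖ - ‖c j‖))]
    _ = ∑ i ∈ F, (∑ j ∈ F, g i j) * ‖c i‖ ^ 2 := by
        simp only [← Finset.sum_div, Finset.sum_add_distrib, hsymm, add_self_div_two,
          Finset.sum_mul]
    _ ≤ θ * ∑ i ∈ F, ‖c i‖ ^ 2 := by
        rw [Finset.mul_sum]
        gcongr with i hi
        exact hθ i hi

theorem sum_norm_sq_inner_le_of_gram {F : Finset I} {v : I → V} {θ : ℝ} (hθ₀ : 0 ≤ θ)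
    (hθ : ∀ i ∈ F, ∑ j ∈ F, ‖inner 𝕜 (v i) (v j)‖ ≤ θ) (x : V) :
    ∑ i ∈ F, ‖inner 𝕜 (v i) x‖ ^ 2 ≤ θ * ‖x‖ ^ 2 := by
  set t := ∑ i ∈ F, ‖inner 𝕜 (v i) x‖ ^ 2 with ht
  set z : V := ∑ i ∈ F, inner 𝕜 (v i) x • v i with hz
  have ht0 : 0 ≤ t := Finset.sum_nonneg fun _ _ => sq_nonneg _
  have hzx : inner 𝕜 z x = (t : 𝕜) := by
    rw [hz, sum_inner, ht]
    push_cast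
    exact Finset.sum_congr rfl fun i _ => by rw [inner_smul_left, RCLike.conj_mul]
  have htz : t ≤ ‖x‖ * ‖z‖ := by
    simpa [hzx, abs_of_nonneg ht0, mul_comm] using norm_inner_le_norm (𝕜 := 𝕜) z x
  exact le_mul_sq_of_le_mul_of_sq_le hθ₀ ht0 htz (norm_sq_sum_smul_le_of_gram hθ _)

end Gram

section Frame

variable {𝕜 : Type*} [RCLike 𝕜] {H : Type*} [NormedAddCommGroup H] [InnerProductSpace 𝕜 H]
  {I : Type*} {f : I → H} {A B : ℝ}

namespace IsFrameForWith

theorem summable_norm_sq_inner (hf : IsFrameForWith 𝕜 ⊤ f A B) (x : H) :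
    Summable fun i => ‖inner 𝕜 (f i) x‖ ^ 2 :=
  (hf.2.2.2 x trivial).1

theorem le_tsum_norm_sq_inner (hf : IsFrameForWith 𝕜 ⊤ f A B) (x : H) :
    A * ‖x‖ ^ 2 ≤ ∑' i, ‖inner 𝕜 (f i) x‖ ^ 2 :=
  (hf.2.2.2 x trivial).2.1

theorem tsum_norm_sq_inner_le (hf : IsFrameForWith 𝕜 ⊤ f A B) (x : H) :
    ∑' i, ‖inner 𝕜 (f i) x‖ ^ 2 ≤ B * ‖x‖ ^ 2 :=
  (hf.2.2.2 x trivial).2.2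

theorem norm_sq_le (hf : IsFrameForWith 𝕜 ⊤ f A B) (i : I) : ‖f i‖ ^ 2 ≤ B := by
  have h : (‖f i‖ ^ 2) ^ 2 ≤ B * ‖f i‖ ^ 2 := calc
    (‖f i‖ ^ 2) ^ 2 = ‖inner 𝕜 (f i) (f i)‖ ^ 2 := by
      rw [inner_self_eq_norm_sq_to_K, norm_pow, RCLike.norm_ofReal, abs_norm]
    _ ≤ ∑' j, ‖inner 𝕜 (f j) (f i)‖ ^ 2 :=
      (hf.summable_norm_sq_inner (f i)).le_tsum i fun _ _ => sq_nonneg _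
    _ ≤ B * ‖f i‖ ^ 2 := hf.tsum_norm_sq_inner_le _
  simpa using le_mul_sq_of_le_mul_of_sq_le hf.2.1.le (sq_nonneg _) (one_mul _).ge h

theorem compl_of_tsum_le (hf : IsFrameForWith 𝕜 ⊤ f A B) {J : Set I} {θ : ℝ} (hθ : θ < 1)
    (hJ : ∀ x, ∑' i : J, ‖inner 𝕜 (f i) x‖ ^ 2 ≤ θ * ∑' i, ‖inner 𝕜 (f i) x‖ ^ 2) :
    IsFrameForWith 𝕜 ⊤ (fun i : (Jᶜ : Set I) => f i) (A * (1 - θ)) B := by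
  refine ⟨mul_pos hf.1 (sub_pos.2 hθ), hf.2.1, fun _ => trivial, fun x _ => ?_⟩
  have hs := hf.summable_norm_sq_inner x
  have hsplit := (hs.subtype J).tsum_add_tsum_compl (hs.subtype Jᶜ)
  refine ⟨hs.subtype Jᶜ, ?_, ?_⟩
  · calc A * (1 - θ) * ‖x‖ ^ 2 = (1 - θ) * (A * ‖x‖ ^ 2) := by ring
      _ ≤ (1 - θ) * ∑' i, ‖inner 𝕜 (f i) x‖ ^ 2 :=
        mul_le_mul_of_nonneg_left (hf.le_tsum_norm_sq_inner x) (sub_nonneg.2 hθ.le)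
      _ ≤ ∑' i : (Jᶜ : Set I), ‖inner 𝕜 (f i) x‖ ^ 2 := by linarith [hJ x]
  · have h₀ : 0 ≤ ∑' i : J, ‖inner 𝕜 (f i) x‖ ^ 2 := tsum_nonneg fun _ => sq_nonneg _
    linarith [hf.tsum_norm_sq_inner_le x]

theorem closedSpan_eq_top [CompleteSpace H] (hf : IsFrameForWith 𝕜 ⊤ f A B) :
    closedSpan 𝕜 f = ⊤ := by
  rw [closedSpan, Submodule.topologicalClosure_eq_top_iff, Submodule.eq_bot_iff]
  intro x hx
  have hx₀ : ∀ i, inner 𝕜 (f i) x = 0 := fun i =>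
    (Submodule.mem_orthogonal _ x).1 hx _ (Submodule.subset_span ⟨i, rfl⟩)
  have h : A * ‖x‖ ^ 2 ≤ 0 := by simpa [hx₀] using hf.le_tsum_norm_sq_inner x
  simpa using nonpos_of_mul_nonpos_right h hf.1

theorem memℓp_inner (hf : IsFrameForWith 𝕜 ⊤ f A B) (x : H) :
    Memℓp (fun i => inner 𝕜 (f i) x) 2 :=
  memℓp_gen (by simpa using hf.summable_norm_sq_inner x)

theorem norm_sq_lp_inner (hf : IsFrameForWith 𝕜 ⊤ f A B) (x : H) :
    ‖(⟨fun i => inner 𝕜 (f i) x, hf.memℓp_inner x⟩ : lp (fun _ : I => 𝕜) 2)‖ ^ 2 =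
      ∑' i, ‖inner 𝕜 (f i) x‖ ^ 2 := by
  simpa using lp.norm_rpow_eq_tsum (p := 2) (by simp)
    (⟨fun i => inner 𝕜 (f i) x, hf.memℓp_inner x⟩ : lp (fun _ : I => 𝕜) 2)

/-- The analysis operator `x ↦ (⟨x, fᵢ⟩)ᵢ` of a frame for `H`, with values in `ℓ²(I)`. -/
noncomputable def analysis (hf : IsFrameForWith 𝕜 ⊤ f A B) : H →L[𝕜] lp (fun _ : I => 𝕜) 2 :=
  LinearMap.mkContinuous
    { toFun := fun x => ⟨fun i => inner 𝕜 (f i) x, hf.memℓp_inner x⟩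
      map_add' := fun x y => by ext i; exact inner_add_right _ _ _
      map_smul' := fun c x => by ext i; exact inner_smul_right _ _ _ }
    √B fun x => by
      refine le_of_sq_le_sq ?_ (by positivity)
      rw [mul_pow, Real.sq_sqrt hf.2.1.le]
      exact (hf.norm_sq_lp_inner x).trans_le (hf.tsum_norm_sq_inner_le x)

theorem analysis_apply (hf : IsFrameForWith 𝕜 ⊤ f A B) (x : H) (i : I) :
    hf.analysis x i = inner 𝕜 (f i) x :=
  rfl

theorem norm_sq_analysis (hf : IsFrameForWith 𝕜 ⊤ f A B) (x : H) :
    ‖hf.analysis x‖ ^ 2 = ∑' i, ‖inner 𝕜 (f i) x‖ ^ 2 :=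
  hf.norm_sq_lp_inner x

variable [CompleteSpace H]

theorem adjoint_analysis_single [DecidableEq I] (hf : IsFrameForWith 𝕜 ⊤ f A B) (i : I) (c : 𝕜) :
    hf.analysis.adjoint (lp.single 2 i c) = c • f i := by
  refine ext_inner_right 𝕜 fun y => ?_
  rw [ContinuousLinearMap.adjoint_inner_left, lp.inner_single_left, analysis_apply,
    inner_smul_left, RCLike.inner_apply, mul_comm]

theorem hasSum_inner_smul (hf : IsFrameForWith 𝕜 ⊤ f A B) (x : H) :
    HasSum (fun i => inner 𝕜 (f i) x • f i) (hf.analysis.adjoint (hf.analysis x)) := by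
  classical
  simpa only [adjoint_analysis_single, analysis_apply] using
    (lp.hasSum_single (by simp) (hf.analysis x)).mapL hf.analysis.adjoint

theorem frameOperator_apply (hf : IsFrameForWith 𝕜 ⊤ f A B) (x : H) :
    frameOperator 𝕜 f x = hf.analysis.adjoint (hf.analysis x) :=
  (hf.hasSum_inner_smul x).tsum_eq

theorem inner_frameOperator_left (hf : IsFrameForWith 𝕜 ⊤ f A B) (x y : H) :
    inner 𝕜 (frameOperator 𝕜 f x) y = inner 𝕜 (hf.analysis x) (hf.analysis y) := by
  rw [hf.frameOperator_apply, ContinuousLinearMap.adjoint_inner_left]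

theorem inner_frameOperator_right (hf : IsFrameForWith 𝕜 ⊤ f A B) (x y : H) :
    inner 𝕜 x (frameOperator 𝕜 f y) = inner 𝕜 (hf.analysis x) (hf.analysis y) := by
  rw [hf.frameOperator_apply, ContinuousLinearMap.adjoint_inner_right]

theorem frameOperator_surjective (hf : IsFrameForWith 𝕜 ⊤ f A B) :
    Function.Surjective (frameOperator 𝕜 f) := by
  let S : H →L[𝕜] H := hf.analysis.adjoint ∘L hf.analysis
  have hS : IsUnit S := by
    refine ContinuousLinearMap.isUnit_of_forall_le_norm_inner_map S (c := ⟨A, hf.1.le⟩) hf.1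
      fun x => ?_
    rw [ContinuousLinearMap.comp_apply, ContinuousLinearMap.adjoint_inner_left,
      inner_self_eq_norm_sq_to_K, norm_pow, RCLike.norm_ofReal, abs_norm, norm_sq_analysis,
      mul_comm]
    exact hf.le_tsum_norm_sq_inner x
  obtain ⟨u, hu⟩ := hS
  intro y
  refine ⟨ContinuousLinearEquiv.ofUnit u |>.symm y, ?_⟩
  rw [hf.frameOperator_apply]
  change S _ = y
  rw [← hu]
  exact (ContinuousLinearEquiv.ofUnit u).apply_symm_apply y

theorem frameOperator_canonicalDual (hf : IsFrameForWith 𝕜 ⊤ f A B) (i : I) :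
    frameOperator 𝕜 f (canonicalDual 𝕜 f i) = f i :=
  Function.invFun_eq (hf.frameOperator_surjective (f i))

theorem inner_canonicalDual_frameOperator (hf : IsFrameForWith 𝕜 ⊤ f A B) (i : I) (y : H) :
    inner 𝕜 (canonicalDual 𝕜 f i) (frameOperator 𝕜 f y) = inner 𝕜 (f i) y := by
  rw [hf.inner_frameOperator_right, ← hf.inner_frameOperator_left,
    hf.frameOperator_canonicalDual]

theorem inner_analysis_canonicalDual (hf : IsFrameForWith 𝕜 ⊤ f A B) (i : I) (x : H) :
    inner 𝕜 (hf.analysis (canonicalDual 𝕜 f i)) (hf.analysis x) = inner 𝕜 (f i) x := by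
  rw [← hf.inner_frameOperator_left, hf.frameOperator_canonicalDual]

theorem hasSum_inner_canonicalDual_mul (hf : IsFrameForWith 𝕜 ⊤ f A B) (x y : H) :
    HasSum (fun i => inner 𝕜 (canonicalDual 𝕜 f i) y * inner 𝕜 x (f i)) (inner 𝕜 x y) := by
  obtain ⟨w, rfl⟩ := hf.frameOperator_surjective y
  simp only [hf.inner_canonicalDual_frameOperator]
  rw [hf.frameOperator_apply]
  simpa only [innerSL_apply_apply, inner_smul_right] using
    (hf.hasSum_inner_smul w).mapL (innerSL 𝕜 x)

protected theorem canonicalDual (hf : IsFrameForWith 𝕜 ⊤ f A B) :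
    IsFrameForWith 𝕜 ⊤ (canonicalDual 𝕜 f) B⁻¹ A⁻¹ := by
  refine ⟨inv_pos.2 hf.2.1, inv_pos.2 hf.1, fun _ => trivial, fun y _ => ?_⟩
  obtain ⟨w, rfl⟩ := hf.frameOperator_surjective y
  set y := frameOperator 𝕜 f w with hy
  simp only [hy, hf.inner_canonicalDual_frameOperator, ← hf.norm_sq_analysis]
  refine ⟨hf.summable_norm_sq_inner w, ?_, ?_⟩
  · have h : ‖y‖ ^ 2 ≤ ‖hf.analysis w‖ * ‖hf.analysis y‖ := by
      rw [← inner_self_eq_norm_sq (𝕜 := 𝕜), hf.inner_frameOperator_left]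
      exact re_inner_le_norm _ _
    rw [inv_mul_le_iff₀ hf.2.1]
    exact le_mul_sq_of_le_mul_of_sq_le hf.2.1.le (sq_nonneg _) h
      ((hf.norm_sq_analysis y).trans_le (hf.tsum_norm_sq_inner_le y))
  · have h : ‖hf.analysis w‖ ^ 2 ≤ ‖y‖ * ‖w‖ := by
      rw [← inner_self_eq_norm_sq (𝕜 := 𝕜), ← hf.inner_frameOperator_left]
      exact re_inner_le_norm _ _
    refine le_mul_sq_of_le_mul_of_sq_le (inv_pos.2 hf.1).le (sq_nonneg _) h ?_
    rw [le_inv_mul_iff₀ hf.1, hf.norm_sq_analysis]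
    exact hf.le_tsum_norm_sq_inner w

theorem dualDiag_eq_norm_sq (hf : IsFrameForWith 𝕜 ⊤ f A B) (i : I) :
    dualDiag 𝕜 f i = ‖hf.analysis (canonicalDual 𝕜 f i)‖ ^ 2 := by
  rw [dualDiag, ← inner_self_eq_norm_sq (𝕜 := 𝕜), hf.inner_analysis_canonicalDual, inner_re_symm]

theorem dualDiag_nonneg (hf : IsFrameForWith 𝕜 ⊤ f A B) (i : I) : 0 ≤ dualDiag 𝕜 f i := by
  rw [hf.dualDiag_eq_norm_sq]
  positivity

theorem norm_inner_canonicalDual_self (hf : IsFrameForWith 𝕜 ⊤ f A B) (i : I) :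
    ‖inner 𝕜 (canonicalDual 𝕜 f i) (f i)‖ = dualDiag 𝕜 f i := by
  rw [hf.dualDiag_eq_norm_sq, norm_inner_symm, ← hf.inner_analysis_canonicalDual,
    inner_self_eq_norm_sq_to_K, norm_pow, RCLike.norm_ofReal, abs_norm]

theorem compl_of_sum_norm_inner_canonicalDual_le (hf : IsFrameForWith 𝕜 ⊤ f A B)
    {J : Set I} {θ : ℝ} (hθ₀ : 0 ≤ θ) (hθ : θ < 1)
    (hJ : ∀ F : Finset I, ↑F ⊆ J → ∀ i ∈ F,
      ∑ j ∈ F, ‖inner 𝕜 (canonicalDual 𝕜 f j) (f i)‖ ≤ θ) :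
    IsFrameForWith 𝕜 ⊤ (fun i : (Jᶜ : Set I) => f i) (A * (1 - θ)) B := by
  refine hf.compl_of_tsum_le hθ fun x =>
    ((hf.summable_norm_sq_inner x).subtype J).tsum_le_of_sum_le fun F => ?_
  set F' : Finset I := F.map (Function.Embedding.subtype _) with hF'
  have hF'J : (F' : Set I) ⊆ J := fun i hi => Finset.property_of_mem_map_subtype F hi
  -- With `C` the analysis operator, `⟨fᵢ, x⟩ = ⟨C f̃ᵢ, C x⟩`, and the vectors `C f̃ᵢ` have the
  -- Gram matrix `⟨fᵢ, f̃ⱼ⟩`.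
  have h := sum_norm_sq_inner_le_of_gram (𝕜 := 𝕜) (F := F')
    (v := fun i => hf.analysis (canonicalDual 𝕜 f i)) hθ₀
    (fun i hi => by
      simpa only [hf.inner_analysis_canonicalDual, norm_inner_symm] using hJ F' hF'J i hi)
    (hf.analysis x)
  simp only [hf.inner_analysis_canonicalDual, hf.norm_sq_analysis, hF', Finset.sum_map] at h
  exact h

end IsFrameForWith

theorem IsRieszBasis.dualDiag_eq_one [CompleteSpace H] (h : IsRieszBasis 𝕜 f)
    (hf : IsFrameForWith 𝕜 ⊤ f A B) (i : I) : dualDiag 𝕜 f i = 1 := by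
  classical
  obtain ⟨b, T, hT⟩ := h
  have hsum := hf.hasSum_inner_smul (canonicalDual 𝕜 f i)
  rw [← hf.frameOperator_apply, hf.frameOperator_canonicalDual] at hsum
  have hcoord := (hsum.mapL (T.symm : H →L[𝕜] H)).mapL (innerSL 𝕜 (b i))
  simp only [hT, map_smul, ContinuousLinearEquiv.coe_coe, ContinuousLinearEquiv.symm_apply_apply,
    innerSL_apply_apply, orthonormal_iff_ite.mp b.orthonormal, if_true, smul_eq_mul] at hcoord
  have hi : inner 𝕜 (f i) (canonicalDual 𝕜 f i) = 1 := by
    simpa [hT] using (hasSum_single i fun j hj => by simp [hj.symm]).unique hcoord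
  rw [dualDiag, inner_re_symm, hi, RCLike.one_re]

end Frame

section UniformLimits

/-- The filter on `ℕ × X` for limits as `N → ∞` that are uniform in the second component; the
densities and upper measures are limits along it with `X = G`, the centres of the boxes. -/
abbrev uniformAtTop (X : Type*) : Filter (ℕ × X) :=
  atTop ×ˢ ⊤

variable {X : Type*}

theorem eventually_uniformAtTop {p : ℕ × X → Prop} :
    (∀ᶠ x in uniformAtTop X, p x) ↔ ∀ᶠ N in atTop, ∀ c, p (N, c) := by
  rw [uniformAtTop, ← principal_univ, eventually_prod_principal_iff]
  simp only [Set.mem_univ, true_imp_iff]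

theorem eventually_uniformAtTop_fst {p : ℕ → Prop} (h : ∀ᶠ N in atTop, p N) :
    ∀ᶠ x in uniformAtTop X, p x.1 :=
  tendsto_fst.eventually h

theorem liminf_iInf_eq_liminf_uniformAtTop {β : Type*} [CompleteLattice β] (u : ℕ × X → β) :
    liminf (fun N => ⨅ c, u (N, c)) atTop = liminf u (uniformAtTop X) := by
  simp only [liminf_eq, eventually_uniformAtTop, le_iInf_iff]

theorem limsup_iSup_eq_limsup_uniformAtTop {β : Type*} [CompleteLattice β] (u : ℕ × X → β) :
    limsup (fun N => ⨆ c, u (N, c)) atTop = limsup u (uniformAtTop X) := by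
  simp only [limsup_eq, eventually_uniformAtTop, iSup_le_iff]

end UniformLimits

section LatticeBoxes

variable {d : ℕ} {X : Type*}

theorem abs_card_Icc_ceil_floor_sub_le {x y : ℝ} (hxy : x ≤ y) :
    |((Finset.Icc ⌈x⌉ ⌊y⌋).card : ℝ) - (y - x)| ≤ 1 := by
  have hle : ⌈x⌉ ≤ ⌊y⌋ + 1 := by
    have h : (⌈x⌉ : ℝ) < ⌊y⌋ + 2 := by linarith [Int.ceil_lt_add_one x, Int.lt_floor_add_one y]
    have h' : ⌈x⌉ < ⌊y⌋ + 2 := by exact_mod_cast h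
    lia
  have hcard : ((Finset.Icc ⌈x⌉ ⌊y⌋).card : ℝ) = ⌊y⌋ + 1 - ⌈x⌉ := by
    exact_mod_cast Int.card_Icc_of_le _ _ hle
  rw [hcard, abs_le]
  constructor <;> linarith [Int.ceil_lt_add_one x, Int.lt_floor_add_one y, Int.le_ceil x,
    Int.floor_le y]

theorem tendsto_card_Icc_div {t : ℝ} (ht : 0 < t) (u : ℝ) (x : X → ℝ) :
    Tendsto (fun p : ℕ × X => ((Finset.Icc ⌈(x p.2 - (p.1 + u) / 2) / t⌉
      ⌊(x p.2 + (p.1 + u) / 2) / t⌋).card : ℝ) / p.1) (uniformAtTop X) (𝓝 t⁻¹) := by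
  rw [tendsto_iff_norm_sub_tendsto_zero]
  refine squeeze_zero' (Eventually.of_forall fun _ => norm_nonneg _) ?_
    ((tendsto_const_div_atTop_nhds_zero_nat (1 + |u / t|)).comp tendsto_fst)
  refine eventually_uniformAtTop.2 ?_
  filter_upwards [eventually_gt_atTop 0, eventually_ge_atTop ⌈-u⌉₊] with N hN hNu c
  have hN' : (0 : ℝ) < N := by exact_mod_cast hN
  have hNu' : 0 ≤ (N + u) / 2 := by linarith [Nat.ceil_le.1 hNu]
  have hxy : (x c - (N + u) / 2) / t ≤ (x c + (N + u) / 2) / t := by gcongr; linarith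
  have h := abs_card_Icc_ceil_floor_sub_le hxy
  set m : ℝ := ((Finset.Icc ⌈(x c - (N + u) / 2) / t⌉ ⌊(x c + (N + u) / 2) / t⌋).card : ℝ)
  calc ‖m / N - t⁻¹‖ = |(m - ((x c + (N + u) / 2) / t - (x c - (N + u) / 2) / t)) + u / t| / N := by
        rw [Real.norm_eq_abs, ← abs_of_pos hN', ← abs_div, abs_of_pos hN']
        congr 1
        field_simp
        ring
    _ ≤ (1 + |u / t|) / N := by
        gcongr
        exact (abs_add_le _ _).trans (by gcongr)

/-- The lattice points `q ∈ ℤᵈ` with `|tᵢ qᵢ - xᵢ| ≤ ρ` for all `i`. -/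
noncomputable def latticeBox (t x : Fin d → ℝ) (ρ : ℝ) : Finset (Fin d → ℤ) :=
  Fintype.piFinset fun i => Finset.Icc ⌈(x i - ρ) / t i⌉ ⌊(x i + ρ) / t i⌋

theorem mem_latticeBox {t x : Fin d → ℝ} (ht : ∀ i, 0 < t i) {ρ : ℝ} {q : Fin d → ℤ} :
    q ∈ latticeBox t x ρ ↔ ∀ i, |t i * q i - x i| ≤ ρ := by
  simp only [latticeBox, Fintype.mem_piFinset, Finset.mem_Icc]
  refine forall_congr' fun i => ?_
  rw [Int.ceil_le, Int.le_floor, div_le_iff₀ (ht i), le_div_iff₀ (ht i), abs_le]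
  constructor <;> rintro ⟨h1, h2⟩ <;> constructor <;> linarith

theorem tendsto_card_latticeBox_div {t : Fin d → ℝ} (ht : ∀ i, 0 < t i) (u : ℝ)
    (x : X → Fin d → ℝ) :
    Tendsto (fun p : ℕ × X => ((latticeBox t (x p.2) ((p.1 + u) / 2)).card : ℝ) / p.1 ^ d)
      (uniformAtTop X) (𝓝 (∏ i, (t i)⁻¹)) := by
  have h := tendsto_finsetProd Finset.univ fun i _ =>
    tendsto_card_Icc_div (ht i) u fun c : X => x c i
  simpa only [latticeBox, Fintype.card_piFinset, Nat.cast_prod, Finset.prod_div_distrib,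
    Finset.prod_const, Finset.card_univ, Fintype.card_fin] using h

end LatticeBoxes

section Boxes

variable {d e : ℕ} {n : Fin e → ℕ} {s : Fin d → ℝ}

theorem gNorm_nonneg (s : Fin d → ℝ) (g : RefGroup d e n) : 0 ≤ gNorm s g :=
  le_max_of_le_left (Real.iSup_nonneg fun _ => abs_nonneg _)

theorem gNorm_le_iff {g : RefGroup d e n} {ρ : ℝ} (hρ : 0 ≤ ρ) :
    gNorm s g ≤ ρ ↔ (∀ i, |s i * (g.1 i : ℝ)| ≤ ρ) ∧
      ∀ k, (if g.2 k = 0 then (0 : ℝ) else 1) ≤ ρ := by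
  rw [gNorm, max_le_iff]
  exact and_congr
    ⟨fun h i => (le_ciSup (Set.finite_range fun i => |s i * (g.1 i : ℝ)|).bddAbove i).trans h,
      fun h => Real.iSup_le h hρ⟩
    ⟨fun h k => (le_ciSup
      (Set.finite_range fun k => if g.2 k = 0 then (0 : ℝ) else 1).bddAbove k).trans h,
      fun h => Real.iSup_le h hρ⟩

theorem abs_mul_le_gNorm (s : Fin d → ℝ) (g : RefGroup d e n) (i : Fin d) :
    |s i * (g.1 i : ℝ)| ≤ gNorm s g :=
  ((gNorm_le_iff (gNorm_nonneg s g)).1 le_rfl).1 i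

theorem gNorm_add_le (s : Fin d → ℝ) (g h : RefGroup d e n) :
    gNorm s (g + h) ≤ gNorm s g + gNorm s h := by
  have hg := (gNorm_le_iff (gNorm_nonneg s g)).1 le_rfl
  have hh := (gNorm_le_iff (gNorm_nonneg s h)).1 le_rfl
  refine (gNorm_le_iff (add_nonneg (gNorm_nonneg s g) (gNorm_nonneg s h))).2
    ⟨fun i => ?_, fun k => ?_⟩
  · simp only [Prod.fst_add, Pi.add_apply, Int.cast_add, mul_add]
    exact (abs_add_le _ _).trans (add_le_add (hg.1 i) (hh.1 i))
  · refine le_trans ?_ (add_le_add (hg.2 k) (hh.2 k))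
    simp only [Prod.snd_add, Pi.add_apply]
    split_ifs <;> simp_all

theorem gNorm_zero (s : Fin d → ℝ) : gNorm s (0 : RefGroup d e n) = 0 :=
  le_antisymm ((gNorm_le_iff le_rfl).2 (by simp)) (gNorm_nonneg s 0)

theorem self_mem_box (s : Fin d → ℝ) (N : ℕ) (j : RefGroup d e n) : j ∈ box s N j := by
  rw [box, Set.mem_ofPred_eq, sub_self, gNorm_zero]
  positivity

theorem mem_box_of_mem_box_sub {N K : ℕ} (hK : K ≤ N) {j k c : RefGroup d e n}
    (hj : j ∈ box s (N - K) c) (hk : k ∈ box s K j) : k ∈ box s N c := by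
  simp only [box, Set.mem_ofPred_eq, Nat.cast_sub hK] at hj hk ⊢
  have h := gNorm_add_le s (k - j) (j - c)
  rw [sub_add_sub_cancel] at h
  linarith

theorem box_mono {N K : ℕ} (hK : K ≤ N) (c : RefGroup d e n) : box s K c ⊆ box s N c := by
  intro k hk
  have h : (K : ℝ) ≤ N := by exact_mod_cast hK
  simp only [box, Set.mem_ofPred_eq] at hk ⊢
  linarith

theorem abs_sub_le_of_mem_box {N : ℕ} {j k : RefGroup d e n} (hk : k ∈ box s N j) (i : Fin d) :
    |s i * (k.1 i : ℝ) - s i * (j.1 i : ℝ)| ≤ (N : ℝ) / 2 := by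
  have h := (abs_mul_le_gNorm s (k - j) i).trans hk
  simpa [mul_sub] using h

theorem mem_box_iff {N : ℕ} (hN : 2 ≤ N) {j k : RefGroup d e n} :
    k ∈ box s N j ↔ ∀ i, |s i * (k.1 i : ℝ) - s i * (j.1 i : ℝ)| ≤ (N : ℝ) / 2 := by
  refine ⟨fun hk => abs_sub_le_of_mem_box hk, fun h =>
    (gNorm_le_iff (by positivity)).2 ⟨fun i => by simpa [mul_sub] using h i, fun l => ?_⟩⟩
  have hN' : (2 : ℝ) ≤ N := by exact_mod_cast hN
  split_ifs <;> linarith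

variable [∀ k, NeZero (n k)]

theorem finite_box (hs : ∀ i, 0 < s i) (N : ℕ) (j : RefGroup d e n) : (box s N j).Finite := by
  refine (latticeBox s (fun i => s i * (j.1 i : ℝ)) (N / 2) ×ˢ Finset.univ).finite_toSet.subset
    fun k hk => ?_
  rw [Finset.mem_coe, Finset.mem_product, mem_latticeBox hs]
  exact ⟨abs_sub_le_of_mem_box hk, Finset.mem_univ _⟩

/-- The box `S_N(j)` as a finite set. -/
noncomputable def boxFinset (hs : ∀ i, 0 < s i) (N : ℕ) (j : RefGroup d e n) :
    Finset (RefGroup d e n) :=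
  (finite_box hs N j).toFinset

theorem mem_boxFinset (hs : ∀ i, 0 < s i) {N : ℕ} {j k : RefGroup d e n} :
    k ∈ boxFinset hs N j ↔ k ∈ box s N j :=
  (finite_box hs N j).mem_toFinset

theorem coe_boxFinset (hs : ∀ i, 0 < s i) (N : ℕ) (j : RefGroup d e n) :
    (boxFinset hs N j : Set (RefGroup d e n)) = box s N j :=
  (finite_box hs N j).coe_toFinset

theorem boxFinset_sub_subset (hs : ∀ i, 0 < s i) (N K : ℕ) (c : RefGroup d e n) :
    boxFinset hs (N - K) c ⊆ boxFinset hs N c :=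
  (finite_box hs (N - K) c).toFinset_subset_toFinset.2 (box_mono (Nat.sub_le N K) c)

theorem card_boxFinset_pos (hs : ∀ i, 0 < s i) (N : ℕ) (j : RefGroup d e n) :
    0 < (boxFinset hs N j).card :=
  Finset.card_pos.2 ⟨j, (mem_boxFinset hs).2 (self_mem_box s N j)⟩

theorem encard_box (hs : ∀ i, 0 < s i) (N : ℕ) (j : RefGroup d e n) :
    (box s N j).encard = (boxFinset hs N j).card := by
  rw [← coe_boxFinset hs, Set.encard_coe_eq_coe_finsetCard]

theorem card_boxFinset (hs : ∀ i, 0 < s i) (N : ℕ) (j : RefGroup d e n) :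
    (boxFinset hs N j).card = (boxFinset hs N (0 : RefGroup d e n)).card :=
  Finset.card_bij' (fun k _ => k - j) (fun k _ => k + j) (by simp [mem_boxFinset, box])
    (by simp [mem_boxFinset, box]) (by simp) (by simp)

theorem boxFinset_eq_product (hs : ∀ i, 0 < s i) {N : ℕ} (hN : 2 ≤ N) (j : RefGroup d e n) :
    boxFinset hs N j = latticeBox s (fun i => s i * (j.1 i : ℝ)) (N / 2) ×ˢ Finset.univ := by
  ext k
  rw [mem_boxFinset, mem_box_iff hN, Finset.mem_product, mem_latticeBox hs,
    and_iff_left (Finset.mem_univ _)]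

/-- The number `V` of elements of `G` per unit volume, so that `|S_N(j)| ∼ V Nᵈ`. -/
noncomputable def boxConstant (s : Fin d → ℝ) (n : Fin e → ℕ) [∀ k, NeZero (n k)] : ℝ :=
  (∏ i, (s i)⁻¹) * Fintype.card ((k : Fin e) → ZMod (n k))

theorem boxConstant_pos (hs : ∀ i, 0 < s i) : 0 < boxConstant s n :=
  mul_pos (Finset.prod_pos fun i _ => inv_pos.2 (hs i)) (by exact_mod_cast Fintype.card_pos)

theorem tendsto_card_boxFinset_sub_div_pow (hs : ∀ i, 0 < s i) (K : ℕ) :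
    Tendsto (fun p : ℕ × RefGroup d e n => ((boxFinset hs (p.1 - K) p.2).card : ℝ) / p.1 ^ d)
      (uniformAtTop (RefGroup d e n)) (𝓝 (boxConstant s n)) := by
  refine ((tendsto_card_latticeBox_div hs (-K) fun (c : RefGroup d e n) i =>
    s i * (c.1 i : ℝ)).mul_const (Fintype.card ((k : Fin e) → ZMod (n k)) : ℝ)).congr' ?_
  refine eventually_uniformAtTop.2 ?_
  filter_upwards [eventually_ge_atTop (K + 2)] with N hN c
  rw [boxFinset_eq_product hs (by lia), Finset.card_product, Nat.cast_mul, Finset.card_univ,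
    Nat.cast_sub (by lia), div_mul_eq_mul_div, sub_eq_add_neg]

theorem tendsto_card_boxFinset_div_pow (hs : ∀ i, 0 < s i) :
    Tendsto (fun p : ℕ × RefGroup d e n => ((boxFinset hs p.1 p.2).card : ℝ) / p.1 ^ d)
      (uniformAtTop (RefGroup d e n)) (𝓝 (boxConstant s n)) :=
  tendsto_card_boxFinset_sub_div_pow hs 0

theorem tendsto_div_card_boxFinset (hs : ∀ i, 0 < s i) {u : ℕ × RefGroup d e n → ℝ} {l : ℝ}
    (hu : Tendsto (fun p => u p / p.1 ^ d) (uniformAtTop (RefGroup d e n)) (𝓝 l)) :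
    Tendsto (fun p => u p / (boxFinset hs p.1 p.2).card) (uniformAtTop (RefGroup d e n))
      (𝓝 (l / boxConstant s n)) := by
  refine (hu.div (tendsto_card_boxFinset_div_pow hs) (boxConstant_pos hs).ne').congr' ?_
  filter_upwards [eventually_uniformAtTop_fst (eventually_gt_atTop 0)] with p hp
  have hp' : (p.1 : ℝ) ≠ 0 := by exact_mod_cast hp.ne'
  exact div_div_div_cancel_right₀ (pow_ne_zero d hp') _ _

theorem eventually_card_boxFinset_sdiff_le (hs : ∀ i, 0 < s i) (K : ℕ) {δ : ℝ} (hδ : 0 < δ) :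
    ∀ᶠ N in atTop, ∀ c : RefGroup d e n,
      ((boxFinset hs N c \ boxFinset hs (N - K) c).card : ℝ) ≤ δ * (boxFinset hs N c).card := by
  have h := tendsto_div_card_boxFinset hs
    (tendsto_card_boxFinset_sub_div_pow (d := d) (e := e) (n := n) hs K)
  rw [div_self (boxConstant_pos hs).ne'] at h
  filter_upwards [eventually_uniformAtTop.1 (h.eventually_const_lt (sub_lt_self 1 hδ))] with N hN c
  have hpos : (0 : ℝ) < (boxFinset hs N c).card := by exact_mod_cast card_boxFinset_pos hs N c
  rw [Finset.cast_card_sdiff (boxFinset_sub_subset hs N K c)]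
  linarith [(lt_div_iff₀ hpos).1 (hN c)]

end Boxes

section FinitePreimages

variable {I X : Type*} {a : I → X}

/-- The preimage of a finite set under a map with finite fibres, as a finite set. -/
noncomputable def finPreimage (ha : ∀ g, (a ⁻¹' {g}).Finite) (Q : Finset X) : Finset I :=
  (Q.finite_toSet.preimage' fun g _ => ha g).toFinset

variable {ha : ∀ g, (a ⁻¹' {g}).Finite}

theorem coe_finPreimage (Q : Finset X) : (finPreimage ha Q : Set I) = a ⁻¹' Q :=
  Set.Finite.coe_toFinset _

theorem mem_finPreimage {Q : Finset X} {i : I} : i ∈ finPreimage ha Q ↔ a i ∈ Q := by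
  simp [finPreimage]

theorem finPreimage_mono {Q' Q : Finset X} (h : Q' ⊆ Q) : finPreimage ha Q' ⊆ finPreimage ha Q :=
  fun _ hi => mem_finPreimage.2 (h (mem_finPreimage.1 hi))

theorem finPreimage_sdiff [DecidableEq I] [DecidableEq X] (Q Q' : Finset X) :
    finPreimage ha (Q \ Q') = finPreimage ha Q \ finPreimage ha Q' := by
  ext i
  simp only [Finset.mem_sdiff, mem_finPreimage]

theorem card_finPreimage_le {K : ℕ} (hK : ∀ g, (a ⁻¹' {g}).ncard ≤ K) (Q : Finset X) :
    (finPreimage ha Q).card ≤ K * Q.card := by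
  classical
  refine Finset.card_le_mul_card_image_of_maps_to (fun i hi => mem_finPreimage.1 hi) K fun g _ => ?_
  rw [← Set.ncard_coe_finset]
  refine (Set.ncard_le_ncard (fun i hi => ?_) (ha g)).trans (hK g)
  exact (Finset.mem_filter.1 (Finset.mem_coe.1 hi)).2

theorem finite_preimage_id_singleton (g : X) : (id ⁻¹' {g} : Set X).Finite :=
  Set.finite_singleton g

theorem finPreimage_id {ha : ∀ g : X, (id ⁻¹' {g}).Finite} (Q : Finset X) :
    finPreimage ha Q = Q := by
  ext i
  exact mem_finPreimage

end FinitePreimages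

section DoubleCounting

variable {I X : Type*}

theorem sum_le_of_le_on_subset [DecidableEq I] {P P' : Finset I} (hP : P' ⊆ P) {g : I → ℝ}
    {δ W : ℝ} (hδ : 0 ≤ δ) (hg : ∀ i ∈ P', g i ≤ δ) (hW : ∀ i, g i ≤ W) :
    ∑ i ∈ P, g i ≤ δ * P.card + W * (P \ P').card := by
  have hP' : ∑ i ∈ P', g i ≤ P'.card * δ := by
    simpa using Finset.sum_le_card_nsmul P' g δ hg
  have hrest : ∑ i ∈ P \ P', g i ≤ (P \ P').card * W := by
    simpa using Finset.sum_le_card_nsmul (P \ P') g W fun i _ => hW i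
  have hcard : (P'.card : ℝ) ≤ P.card := by exact_mod_cast Finset.card_le_card hP
  rw [← Finset.sum_sdiff hP]
  linarith [mul_le_mul_of_nonneg_left hcard hδ]

theorem sum_sub_sum_le_of_abs_sub_sum_le [DecidableEq I] [DecidableEq X] {P P' : Finset I}
    {Q Q' : Finset X} (hP : P' ⊆ P) (hQ : Q' ⊆ Q) {m : I → X → ℝ} {u : I → ℝ} {v : X → ℝ}
    {δ W : ℝ} (hδ : 0 ≤ δ)
    (hrow : ∀ i ∈ P', |u i - ∑ j ∈ Q, m i j| ≤ δ) (hrowW : ∀ i, |u i - ∑ j ∈ Q, m i j| ≤ W)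
    (hcol : ∀ j ∈ Q', |v j - ∑ i ∈ P, m i j| ≤ δ) (hcolW : ∀ j, |v j - ∑ i ∈ P, m i j| ≤ W) :
    ∑ i ∈ P, u i - ∑ j ∈ Q, v j ≤
      δ * (P.card + Q.card) + W * ((P \ P').card + (Q \ Q').card) := calc
  ∑ i ∈ P, u i - ∑ j ∈ Q, v j
      = ∑ i ∈ P, (u i - ∑ j ∈ Q, m i j) - ∑ j ∈ Q, (v j - ∑ i ∈ P, m i j) := by
        rw [Finset.sum_sub_distrib, Finset.sum_sub_distrib, Finset.sum_comm (s := Q)]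
        ring
  _ ≤ ∑ i ∈ P, |u i - ∑ j ∈ Q, m i j| + ∑ j ∈ Q, |v j - ∑ i ∈ P, m i j| := by
        rw [sub_eq_add_neg, ← Finset.sum_neg_distrib]
        gcongr
        exacts [le_abs_self _, neg_le_abs _]
  _ ≤ (δ * P.card + W * (P \ P').card) + (δ * Q.card + W * (Q \ Q').card) :=
        add_le_add (sum_le_of_le_on_subset hP hδ hrow hrowW)
          (sum_le_of_le_on_subset hQ hδ hcol hcolW)
  _ = δ * (P.card + Q.card) + W * ((P \ P').card + (Q \ Q').card) := by ring

theorem abs_sub_sum_le_of_tail_le {m x y : I → ℝ} {t δ C : ℝ} (hm : HasSum m t)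
    (hxy : ∀ i, |m i| ≤ x i * y i) (hx₀ : ∀ i, 0 ≤ x i) (hy₀ : ∀ i, 0 ≤ y i)
    (hx : Summable fun i => x i ^ 2) (hy : Summable fun i => y i ^ 2) (hC : ∑' i, y i ^ 2 ≤ C)
    (hδ : 0 ≤ δ) {T : Finset I} (hT : ∑' i : ((T : Set I)ᶜ : Set I), x i ^ 2 ≤ δ ^ 2) :
    |t - ∑ i ∈ T, m i| ≤ δ * √C := by
  set Tc : Set I := (T : Set I)ᶜ
  have htail : t - ∑ i ∈ T, m i = ∑' i : Tc, m i := by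
    rw [← hm.tsum_eq, ← hm.summable.sum_add_tsum_compl (s := T), add_sub_cancel_left]
  have hxc : Summable fun i : Tc => x i ^ 2 := hx.subtype Tc
  have hyc : Summable fun i : Tc => y i ^ 2 := hy.subtype Tc
  obtain ⟨hsum, hcs⟩ := Real.summable_and_inner_le_Lp_mul_Lq_tsum_of_nonneg
    Real.HolderConjugate.two_two (fun i : Tc => hx₀ i) (fun i : Tc => hy₀ i)
    (by simpa using hxc) (by simpa using hyc)
  simp only [Real.rpow_two, ← Real.sqrt_eq_rpow] at hcs
  rw [htail, ← Real.norm_eq_abs]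
  calc ‖∑' i : Tc, m i‖ ≤ ∑' i : Tc, x i * y i :=
        tsum_of_norm_bounded hsum.hasSum fun i : Tc => hxy i
    _ ≤ √(∑' i : Tc, x i ^ 2) * √(∑' i : Tc, y i ^ 2) := hcs
    _ ≤ δ * √C := by
        gcongr
        · exact Real.sqrt_le_left hδ |>.2 hT
        · exact (hy.tsum_subtype_le _ Tc fun _ => sq_nonneg _).trans hC

end DoubleCounting

section MixedGram

variable {𝕜 : Type*} [RCLike 𝕜] {H : Type*} [NormedAddCommGroup H] [InnerProductSpace 𝕜 H]
  {I X : Type*} {f : I → H} {E : X → H} {A B A' B' : ℝ}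

variable (𝕜) in
/-- The matrix `Re ⟨fᵢ, eₓ⟩ ⟨ẽₓ, f̃ᵢ⟩` comparing two frames: its row sums are `⟨fᵢ, f̃ᵢ⟩` and its
column sums are `⟨eₓ, ẽₓ⟩`. -/
noncomputable def mixedGram (f : I → H) (E : X → H) (i : I) (x : X) : ℝ :=
  RCLike.re (inner 𝕜 (canonicalDual 𝕜 E x) (canonicalDual 𝕜 f i) * inner 𝕜 (f i) (E x))

theorem mixedGram_comm (f : I → H) (E : X → H) (i : I) (x : X) :
    mixedGram 𝕜 f E i x = mixedGram 𝕜 E f x i := by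
  rw [mixedGram, mixedGram, ← RCLike.conj_re, map_mul, inner_conj_symm, inner_conj_symm]

theorem abs_mixedGram_le (f : I → H) (E : X → H) (i : I) (x : X) :
    |mixedGram 𝕜 f E i x| ≤
      ‖inner 𝕜 (E x) (f i)‖ * ‖inner 𝕜 (canonicalDual 𝕜 E x) (canonicalDual 𝕜 f i)‖ := by
  refine (RCLike.abs_re_le_norm _).trans_eq ?_
  rw [norm_mul, mul_comm, norm_inner_symm (f i)]

variable [CompleteSpace H]

theorem IsFrameForWith.hasSum_mixedGram (hE : IsFrameForWith 𝕜 ⊤ E A' B') (i : I) :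
    HasSum (mixedGram 𝕜 f E i) (dualDiag 𝕜 f i) := by
  rw [dualDiag, inner_re_symm]
  exact (hE.hasSum_inner_canonicalDual_mul (f i) (canonicalDual 𝕜 f i)).mapL RCLike.reCLM

theorem abs_dualDiag_sub_sum_mixedGram_le_of_tail_le (hf : IsFrameForWith 𝕜 ⊤ f A B)
    (hE : IsFrameForWith 𝕜 ⊤ E A' B') {i : I} {T : Finset X} {δ : ℝ} (hδ : 0 ≤ δ)
    (hT : ∑' x : ((T : Set X)ᶜ : Set X), ‖inner 𝕜 (E x) (f i)‖ ^ 2 ≤ δ ^ 2) :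
    |dualDiag 𝕜 f i - ∑ x ∈ T, mixedGram 𝕜 f E i x| ≤ δ * √(A⁻¹ * A'⁻¹) := by
  refine abs_sub_sum_le_of_tail_le (hE.hasSum_mixedGram i) (abs_mixedGram_le f E i)
    (fun _ => norm_nonneg _) (fun _ => norm_nonneg _) (hE.summable_norm_sq_inner _)
    (hE.canonicalDual.summable_norm_sq_inner _) ?_ hδ hT
  refine (hE.canonicalDual.tsum_norm_sq_inner_le _).trans ?_
  rw [mul_comm]
  exact mul_le_mul_of_nonneg_right (hf.canonicalDual.norm_sq_le i) (inv_pos.2 hE.1).le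

theorem abs_dualDiag_sub_sum_mixedGram_le (hf : IsFrameForWith 𝕜 ⊤ f A B)
    (hE : IsFrameForWith 𝕜 ⊤ E A' B') (i : I) (T : Finset X) :
    |dualDiag 𝕜 f i - ∑ x ∈ T, mixedGram 𝕜 f E i x| ≤ √(B * B') * √(A⁻¹ * A'⁻¹) := by
  refine abs_dualDiag_sub_sum_mixedGram_le_of_tail_le hf hE (Real.sqrt_nonneg _) ?_
  rw [Real.sq_sqrt (mul_pos hf.2.1 hE.2.1).le]
  calc ∑' x : ((T : Set X)ᶜ : Set X), ‖inner 𝕜 (E x) (f i)‖ ^ 2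
      ≤ ∑' x, ‖inner 𝕜 (E x) (f i)‖ ^ 2 :=
        (hE.summable_norm_sq_inner (f i)).tsum_subtype_le _ _ fun _ => sq_nonneg _
    _ ≤ B' * ‖f i‖ ^ 2 := hE.tsum_norm_sq_inner_le _
    _ ≤ B * B' := by
        rw [mul_comm B]
        exact mul_le_mul_of_nonneg_left (hf.norm_sq_le i) hE.2.1.le

end MixedGram

section Comparison

variable {𝕜 : Type*} [RCLike 𝕜] {H : Type*} [NormedAddCommGroup H] [InnerProductSpace 𝕜 H]
  {d e : ℕ} {n : Fin e → ℕ} {I : Type*} {s : Fin d → ℝ} {a : I → RefGroup d e n}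
  {f : I → H} {E : RefGroup d e n → H} {A B A' B' : ℝ}

theorem tsum_compl_norm_sq_le_of_enorm_lt {ι : Type*} {z : ι → 𝕜}
    (hz : Summable fun i => ‖z i‖ ^ 2) {s t : Set ι} (hst : s ⊆ t) {ε : ℝ} (hε : 0 ≤ ε)
    (h : ∑' i : (sᶜ : Set ι), ‖z i‖ₑ ^ 2 < ENNReal.ofReal ε) :
    ∑' i : (tᶜ : Set ι), ‖z i‖ ^ 2 ≤ ε := by
  have hz' : Summable fun i : (tᶜ : Set ι) => ‖z i‖ ^ 2 := hz.subtype _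
  rw [← ENNReal.ofReal_le_ofReal_iff hε, ENNReal.ofReal_tsum_of_nonneg (fun _ => sq_nonneg _) hz']
  refine le_trans ?_ h.le
  simp only [ENNReal.ofReal_pow (norm_nonneg _), ofReal_norm]
  exact ENNReal.tsum_mono_subtype (fun i => ‖z i‖ₑ ^ 2) (Set.compl_subset_compl.2 hst)

theorem HasL2RowDecay.exists_tsum_compl_le (hrow : HasL2RowDecay 𝕜 s a f E)
    (hE : IsFrameForWith 𝕜 ⊤ E A' B') {ε : ℝ} (hε : 0 < ε) :
    ∃ K, ∀ i T, box s K (a i) ⊆ T → ∑' j : (Tᶜ : Set _), ‖inner 𝕜 (E j) (f i)‖ ^ 2 ≤ ε := by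
  obtain ⟨K, -, hK⟩ := hrow ε hε
  exact ⟨K, fun i T hT =>
    tsum_compl_norm_sq_le_of_enorm_lt (hE.summable_norm_sq_inner (f i)) hT hε.le (hK i)⟩

theorem HasL2ColumnDecay.exists_tsum_compl_le (hcol : HasL2ColumnDecay 𝕜 s a f E)
    (hf : IsFrameForWith 𝕜 ⊤ f A B) {ε : ℝ} (hε : 0 < ε) :
    ∃ K, ∀ j T, preBox s a K j ⊆ T → ∑' i : (Tᶜ : Set I), ‖inner 𝕜 (f i) (E j)‖ ^ 2 ≤ ε := by
  obtain ⟨K, -, hK⟩ := hcol ε hε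
  refine ⟨K, fun j T hT => ?_⟩
  have hs := hf.summable_norm_sq_inner (E j)
  simp only [norm_inner_symm _ (E j)] at hs ⊢
  exact tsum_compl_norm_sq_le_of_enorm_lt hs hT hε.le (hK j)

variable [∀ k, NeZero (n k)] [CompleteSpace H]

theorem exists_sum_dualDiag_sub_sum_dualDiag_le (hs : ∀ i, 0 < s i)
    (hf : IsFrameForWith 𝕜 ⊤ f A B) (hE : IsFrameForWith 𝕜 ⊤ E A' B')
    (hcol : HasL2ColumnDecay 𝕜 s a f E) (hrow : HasL2RowDecay 𝕜 s a f E)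
    (ha : ∀ g, (a ⁻¹' {g}).Finite) {δ : ℝ} (hδ : 0 < δ) :
    ∃ R, ∀ N ≥ R, ∀ c : RefGroup d e n,
      ∑ i ∈ finPreimage ha (boxFinset hs N c), dualDiag 𝕜 f i -
          ∑ j ∈ boxFinset hs N c, dualDiag 𝕜 E j ≤
        δ * √(A⁻¹ * A'⁻¹) * ((finPreimage ha (boxFinset hs N c)).card + (boxFinset hs N c).card) +
          √(B * B') * √(A⁻¹ * A'⁻¹) *
            ((finPreimage ha (boxFinset hs N c \ boxFinset hs (N - R) c)).card +
              (boxFinset hs N c \ boxFinset hs (N - R) c).card) := by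
  classical
  obtain ⟨K₁, hK₁⟩ := hcol.exists_tsum_compl_le hf (ε := δ ^ 2) (by positivity)
  obtain ⟨K₂, hK₂⟩ := hrow.exists_tsum_compl_le hE (ε := δ ^ 2) (by positivity)
  refine ⟨max K₁ K₂, fun N hN c => ?_⟩
  set R := max K₁ K₂
  have hin : ∀ K ≤ R, ∀ j ∈ boxFinset hs (N - R) c, box s K j ⊆ boxFinset hs N c :=
    fun K hKR j hj k hk => (mem_boxFinset hs).2 <|
      mem_box_of_mem_box_sub hN ((mem_boxFinset hs).1 hj) (box_mono hKR j hk)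
  rw [finPreimage_sdiff]
  refine sum_sub_sum_le_of_abs_sub_sum_le
    (finPreimage_mono (boxFinset_sub_subset hs N R c)) (boxFinset_sub_subset hs N R c)
    (m := mixedGram 𝕜 f E) (by positivity) (fun i hi => ?_) (fun i => ?_) (fun j hj => ?_)
    fun j => ?_
  · exact abs_dualDiag_sub_sum_mixedGram_le_of_tail_le hf hE hδ.le <|
      hK₂ i _ (hin K₂ (le_max_right _ _) _ (mem_finPreimage.1 hi))
  · exact abs_dualDiag_sub_sum_mixedGram_le hf hE i _
  · simp only [mixedGram_comm f E, mul_comm A⁻¹]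
    refine abs_dualDiag_sub_sum_mixedGram_le_of_tail_le hE hf hδ.le <| hK₁ j _ ?_
    rw [coe_finPreimage]
    exact Set.preimage_mono (hin K₁ (le_max_left _ _) j hj)
  · simp only [mixedGram_comm f E, mul_comm A⁻¹, mul_comm B]
    exact abs_dualDiag_sub_sum_mixedGram_le hE hf j _

theorem eventually_sum_dualDiag_le (hs : ∀ i, 0 < s i) (hf : IsFrameForWith 𝕜 ⊤ f A B)
    (hE : IsFrameForWith 𝕜 ⊤ E A' B') (hcol : HasL2ColumnDecay 𝕜 s a f E)
    (hrow : HasL2RowDecay 𝕜 s a f E) (ha : ∀ g, (a ⁻¹' {g}).Finite) {K : ℕ}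
    (hK : ∀ g, (a ⁻¹' {g}).ncard ≤ K) {η : ℝ} (hη : 0 < η) :
    ∀ᶠ N in atTop, ∀ c : RefGroup d e n,
      ∑ i ∈ finPreimage ha (boxFinset hs N c), dualDiag 𝕜 f i ≤
        ∑ j ∈ boxFinset hs N c, dualDiag 𝕜 E j + η * (boxFinset hs N c).card := by
  set w := √(A⁻¹ * A'⁻¹)
  set b := √(B * B')
  have hb : 0 ≤ b := Real.sqrt_nonneg _
  have hw : 0 < w := Real.sqrt_pos.2 (mul_pos (inv_pos.2 hf.1) (inv_pos.2 hE.1))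
  set δ := η / ((K + 1) * (w * (1 + b))) with hδ
  have hδ₀ : 0 < δ := by positivity
  obtain ⟨R, hR⟩ := exists_sum_dualDiag_sub_sum_dualDiag_le hs hf hE hcol hrow ha hδ₀
  filter_upwards [eventually_card_boxFinset_sdiff_le (e := e) (n := n) hs R hδ₀,
    eventually_ge_atTop R] with N hbd hRN c
  have hcard : ∀ Q : Finset (RefGroup d e n),
      ((finPreimage ha Q).card + Q.card : ℝ) ≤ (K + 1) * Q.card := fun Q => by
    rw [add_one_mul]
    gcongr
    exact_mod_cast card_finPreimage_le hK Q
  set Q := boxFinset hs N c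
  rw [← sub_le_iff_le_add']
  calc _ ≤ δ * w * ((K + 1) * Q.card) + b * w * ((K + 1) * (δ * Q.card)) := by
        refine (hR N hRN c).trans ?_
        gcongr
        · exact hcard Q
        · exact (hcard _).trans (by gcongr; exact hbd c)
    _ = η * Q.card := by
        rw [hδ]
        field_simp

end Comparison

section Densities

variable {d e : ℕ} {n : Fin e → ℕ} [∀ k, NeZero (n k)] {I : Type*} {s : Fin d → ℝ}
  {a : I → RefGroup d e n}

theorem exists_ncard_fiber_le (hs : ∀ i, 0 < s i) (h : upperDensity s a < ⊤) :
    ∃ K : ℕ, ∀ g, (a ⁻¹' {g}).Finite ∧ (a ⁻¹' {g}).ncard ≤ K := by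
  obtain ⟨b, hb, -⟩ := ENNReal.lt_iff_exists_nnreal_btwn.1 h
  obtain ⟨N, hN⟩ := (eventually_lt_of_limsup_lt hb).exists
  obtain ⟨K, hK⟩ := exists_nat_ge (b * (boxFinset hs N (0 : RefGroup d e n)).card : NNReal)
  refine ⟨K, fun g => ?_⟩
  have hratio := iSup_le_iff.1 hN.le g
  rw [encard_box hs, ENat.toENNReal_coe, card_boxFinset hs, ENNReal.div_le_iff
    (by exact_mod_cast (card_boxFinset_pos hs N _).ne') (ENNReal.natCast_ne_top _)] at hratio
  have hfiber : a ⁻¹' {g} ⊆ preBox s a N g := by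
    rintro i rfl
    exact self_mem_box s N _
  rw [← Set.encard_le_coe_iff_finite_ncard_le, ← ENat.toENNReal_le]
  calc ((a ⁻¹' {g}).encard : ℝ≥0∞) ≤ (preBox s a N g).encard :=
        ENat.toENNReal_le.2 (Set.encard_le_encard hfiber)
    _ ≤ b * (boxFinset hs N (0 : RefGroup d e n)).card := hratio
    _ ≤ ((K : ℕ∞) : ℝ≥0∞) := by simpa using ENNReal.coe_le_coe.2 hK

variable (hs : ∀ i, 0 < s i) (ha : ∀ g, (a ⁻¹' {g}).Finite)

theorem coe_finPreimage_boxFinset (N : ℕ) (c : RefGroup d e n) :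
    (finPreimage ha (boxFinset hs N c) : Set I) = preBox s a N c := by
  rw [coe_finPreimage, coe_boxFinset, preBox]

theorem encard_preBox (N : ℕ) (c : RefGroup d e n) :
    (preBox s a N c).encard = (finPreimage ha (boxFinset hs N c)).card := by
  rw [← coe_finPreimage_boxFinset hs ha, Set.encard_coe_eq_coe_finsetCard]

theorem encard_preBox_div_encard_box (N : ℕ) (c : RefGroup d e n) :
    ((preBox s a N c).encard : ℝ≥0∞) / ((box s N c).encard : ℝ≥0∞) =
      ENNReal.ofReal ((finPreimage ha (boxFinset hs N c)).card / (boxFinset hs N c).card) := by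
  rw [encard_preBox hs ha, encard_box hs, ENat.toENNReal_coe, ENat.toENNReal_coe,
    ENNReal.ofReal_div_of_pos (by exact_mod_cast card_boxFinset_pos hs N c),
    ENNReal.ofReal_natCast, ENNReal.ofReal_natCast]

theorem tsum_preBox_div_encard_preBox {g : I → ℝ} (hg : ∀ i, 0 ≤ g i) (N : ℕ)
    (c : RefGroup d e n) :
    (∑' i : preBox s a N c, ENNReal.ofReal (g i)) / ((preBox s a N c).encard : ℝ≥0∞) =
      ENNReal.ofReal ((∑ i ∈ finPreimage ha (boxFinset hs N c), g i) /
        (finPreimage ha (boxFinset hs N c)).card) := by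
  rw [encard_preBox hs ha, ENat.toENNReal_coe, ← coe_finPreimage_boxFinset hs ha,
    Finset.tsum_subtype' _ fun i => ENNReal.ofReal (g i),
    ← ENNReal.ofReal_sum_of_nonneg fun i _ => hg i]
  rcases (finPreimage ha (boxFinset hs N c)).eq_empty_or_nonempty with hP | hP
  · simp [hP]
  · rw [ENNReal.ofReal_div_of_pos (by exact_mod_cast hP.card_pos), ENNReal.ofReal_natCast]

theorem lowerDensity_eq_liminf :
    lowerDensity s a = liminf (fun p : ℕ × RefGroup d e n => ENNReal.ofReal
      ((finPreimage ha (boxFinset hs p.1 p.2)).card / (boxFinset hs p.1 p.2).card))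
      (uniformAtTop (RefGroup d e n)) := by
  simp only [lowerDensity, encard_preBox_div_encard_box hs ha,
    ← liminf_iInf_eq_liminf_uniformAtTop]

theorem upperDensity_eq_limsup :
    upperDensity s a = limsup (fun p : ℕ × RefGroup d e n => ENNReal.ofReal
      ((finPreimage ha (boxFinset hs p.1 p.2)).card / (boxFinset hs p.1 p.2).card))
      (uniformAtTop (RefGroup d e n)) := by
  simp only [upperDensity, encard_preBox_div_encard_box hs ha,
    ← limsup_iSup_eq_limsup_uniformAtTop]

theorem eventually_mul_card_lt_card_of_lt_lowerDensity {q : NNReal}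
    (hq : (q : ℝ≥0∞) < lowerDensity s a) :
    ∀ᶠ N in atTop, ∀ c : RefGroup d e n,
      (q : ℝ) * (boxFinset hs N c).card < (finPreimage ha (boxFinset hs N c)).card := by
  rw [lowerDensity_eq_liminf hs ha] at hq
  refine (eventually_uniformAtTop.1 (eventually_lt_of_lt_liminf hq)).mono fun N hN c => ?_
  rw [← lt_div_iff₀ (by exact_mod_cast card_boxFinset_pos hs N c)]
  exact NNReal.coe_lt_coe.2 (ENNReal.coe_lt_coe.1 (hN c)) |>.trans_eq
    (Real.coe_toNNReal _ (by positivity))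

end Densities

section UpperMeasure

variable {𝕜 : Type*} [RCLike 𝕜] {H : Type*} [NormedAddCommGroup H] [InnerProductSpace 𝕜 H]
  [CompleteSpace H] {d e : ℕ} {n : Fin e → ℕ} [∀ k, NeZero (n k)] {I : Type*} {s : Fin d → ℝ}
  {a : I → RefGroup d e n} {f : I → H} {E : RefGroup d e n → H} {A B A' B' : ℝ}

theorem upperMeasure_eq_limsup (hs : ∀ i, 0 < s i) (ha : ∀ g, (a ⁻¹' {g}).Finite)
    (hf : IsFrameForWith 𝕜 ⊤ f A B) :
    upperMeasure 𝕜 s a f = limsup (fun p : ℕ × RefGroup d e n => ENNReal.ofReal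
      ((∑ i ∈ finPreimage ha (boxFinset hs p.1 p.2), dualDiag 𝕜 f i) /
        (finPreimage ha (boxFinset hs p.1 p.2)).card)) (uniformAtTop (RefGroup d e n)) := by
  simp only [upperMeasure, tsum_preBox_div_encard_preBox hs ha hf.dualDiag_nonneg,
    ← limsup_iSup_eq_limsup_uniformAtTop]

theorem eventually_sum_dualDiag_le_mul_card_of_upperMeasure_lt (hs : ∀ i, 0 < s i)
    (ha : ∀ g, (a ⁻¹' {g}).Finite) (hf : IsFrameForWith 𝕜 ⊤ f A B) {v : ℝ}
    (h : upperMeasure 𝕜 s a f < ENNReal.ofReal v) :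
    ∀ᶠ N in atTop, ∀ c : RefGroup d e n,
      ∑ i ∈ finPreimage ha (boxFinset hs N c), dualDiag 𝕜 f i ≤
        v * (finPreimage ha (boxFinset hs N c)).card := by
  rw [upperMeasure_eq_limsup hs ha hf] at h
  refine (eventually_uniformAtTop.1 (eventually_lt_of_limsup_lt h)).mono fun N hN c => ?_
  rcases (finPreimage ha (boxFinset hs N c)).eq_empty_or_nonempty with hP | hP
  · simp [hP]
  · rw [← div_le_iff₀ (by exact_mod_cast hP.card_pos)]
    exact (ENNReal.ofReal_lt_ofReal_iff'.1 (hN c)).1.le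

theorem upperMeasure_le_of_eventually_sum_dualDiag_le (hs : ∀ i, 0 < s i)
    (ha : ∀ g, (a ⁻¹' {g}).Finite) (hf : IsFrameForWith 𝕜 ⊤ f A B) {v : ℝ} (hv : 0 ≤ v)
    (h : ∀ᶠ N in atTop, ∀ c : RefGroup d e n,
      ∑ i ∈ finPreimage ha (boxFinset hs N c), dualDiag 𝕜 f i ≤
        v * (finPreimage ha (boxFinset hs N c)).card) :
    upperMeasure 𝕜 s a f ≤ ENNReal.ofReal v := by
  rw [upperMeasure_eq_limsup hs ha hf]
  refine limsup_le_of_le (by isBoundedDefault) (eventually_uniformAtTop.2 (h.mono fun N hN c => ?_))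
  exact ENNReal.ofReal_le_ofReal (div_le_of_le_mul₀ (by positivity) hv (hN c))

theorem IsRieszBasis.upperMeasure_eq_one (hs : ∀ i, 0 < s i) (h : IsRieszBasis 𝕜 E)
    (hE : IsFrameForWith 𝕜 ⊤ E A B) : upperMeasure 𝕜 s id E = 1 := by
  have hne : ∀ N c, ((boxFinset hs N c : Finset (RefGroup d e n)).card : ℝ) ≠ 0 := fun N c => by
    exact_mod_cast (card_boxFinset_pos hs N c).ne'
  simp [upperMeasure_eq_limsup hs finite_preimage_id_singleton hE, finPreimage_id,
    h.dualDiag_eq_one hE, div_self (hne _ _)]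

theorem upperMeasure_lt_one (hs : ∀ i, 0 < s i) (hf : IsFrameForWith 𝕜 ⊤ f A B)
    (hE : IsFrameForWith 𝕜 ⊤ E A' B') (hup : upperDensity s a < ⊤)
    (hcol : HasL2ColumnDecay 𝕜 s a f E) (hrow : HasL2RowDecay 𝕜 s a f E)
    (h : upperMeasure 𝕜 s id E < lowerDensity s a) : upperMeasure 𝕜 s a f < 1 := by
  obtain ⟨K, hK⟩ := exists_ncard_fiber_le hs hup
  have ha g := (hK g).1
  obtain ⟨q, hEq, hq⟩ := ENNReal.lt_iff_exists_nnreal_btwn.1 h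
  obtain ⟨p, hEp, hpq⟩ := ENNReal.lt_iff_exists_nnreal_btwn.1 hEq
  have hpq' : (p : ℝ) < q := by exact_mod_cast hpq
  have hp : (0 : ℝ) ≤ p := p.2
  have hq₀ : (0 : ℝ) < q := hp.trans_lt hpq'
  rw [← ENNReal.ofReal_coe_nnreal] at hEp
  set v : ℝ := ((p : ℝ) + (q - p) / 2) / q with hv
  have hv₀ : 0 ≤ v := div_nonneg (by linarith) hq₀.le
  have hv₁ : v < 1 := by rw [hv, div_lt_one hq₀]; linarith
  refine lt_of_le_of_lt ?_ (ENNReal.ofReal_lt_one.2 hv₁)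
  refine upperMeasure_le_of_eventually_sum_dualDiag_le hs ha hf hv₀ ?_
  filter_upwards [eventually_sum_dualDiag_le_mul_card_of_upperMeasure_lt hs
      finite_preimage_id_singleton hE hEp,
    eventually_mul_card_lt_card_of_lt_lowerDensity hs ha hq,
    eventually_sum_dualDiag_le hs hf hE hcol hrow ha (fun g => (hK g).2)
      (half_pos (sub_pos.2 hpq'))]
    with N hsumE hcard hsum c
  simp only [finPreimage_id] at hsumE
  calc ∑ i ∈ finPreimage ha (boxFinset hs N c), dualDiag 𝕜 f i
      ≤ p * (boxFinset hs N c).card + (q - p) / 2 * (boxFinset hs N c).card :=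
        (hsum c).trans (by gcongr; exact hsumE c)
    _ = v * (q * (boxFinset hs N c).card) := by
        rw [hv]
        field_simp
    _ ≤ v * (finPreimage ha (boxFinset hs N c)).card :=
        mul_le_mul_of_nonneg_left (hcard c).le hv₀

theorem exists_forall_exists_dualDiag_le_mem_box (hs : ∀ i, 0 < s i)
    (hf : IsFrameForWith 𝕜 ⊤ f A B) (hlow : 0 < lowerDensity s a) (hup : upperDensity s a < ⊤)
    {α : ℝ} (h : upperMeasure 𝕜 s a f < ENNReal.ofReal α) :
    ∃ M : ℕ, ∀ c : RefGroup d e n, ∃ i ∈ {i | dualDiag 𝕜 f i ≤ α}, a i ∈ box s M c := by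
  obtain ⟨K, hK⟩ := exists_ncard_fiber_le hs hup
  have ha g := (hK g).1
  obtain ⟨M, hcard, hsum⟩ :=
    ((eventually_mul_card_lt_card_of_lt_lowerDensity (q := 0) hs ha (by simpa using hlow)).and
      (eventually_sum_dualDiag_le_mul_card_of_upperMeasure_lt hs ha hf h)).exists
  refine ⟨M, fun c => ?_⟩
  have hP : (finPreimage ha (boxFinset hs M c)).Nonempty := by simpa using hcard c
  obtain ⟨i, hi, hiα⟩ := Finset.exists_le_of_sum_le hP
    (f := dualDiag 𝕜 f) (g := fun _ => α) (by simpa [mul_comm] using hsum c)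
  exact ⟨i, hiα, (mem_boxFinset hs).1 (mem_finPreimage.1 hi)⟩

end UpperMeasure

section SparseSubset

variable {d e : ℕ} {n : Fin e → ℕ} {I : Type*} {s : Fin d → ℝ} {a : I → RefGroup d e n}

theorem encard_preBox_comp_equiv {I' : Type*} (φ : I' ≃ I) (N : ℕ) (c : RefGroup d e n) :
    (preBox s (a ∘ φ) N c).encard = (preBox s a N c).encard :=
  Set.encard_preimage_of_bijective φ.bijective (preBox s a N c)

theorem lowerDensity_comp_equiv {I' : Type*} (φ : I' ≃ I) :
    lowerDensity s (a ∘ φ) = lowerDensity s a := by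
  simp only [lowerDensity, encard_preBox_comp_equiv]

theorem upperDensity_comp_equiv {I' : Type*} (φ : I' ≃ I) :
    upperDensity s (a ∘ φ) = upperDensity s a := by
  simp only [upperDensity, encard_preBox_comp_equiv]

theorem lt_gNorm_sub_of_abs_sub_le {b : (Fin d → ℤ) → RefGroup d e n} {t : Fin d → ℝ} {M R : ℝ}
    (hb : ∀ q i, |s i * ((b q).1 i : ℝ) - t i * q i| ≤ M / 2) (hM : 0 ≤ M) (hR : 0 ≤ R)
    (ht : ∀ i, R + M < t i) {q q' : Fin d → ℤ} (hne : q ≠ q') : R < gNorm s (b q - b q') := by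
  obtain ⟨i, hi⟩ := Function.ne_iff.1 hne
  have hti : 0 ≤ t i := by linarith [ht i]
  have hlattice : t i ≤ |t i * q i - t i * q' i| := by
    rw [← mul_sub, abs_mul, abs_of_nonneg hti]
    refine le_mul_of_one_le_right hti ?_
    exact_mod_cast Int.one_le_abs (sub_ne_zero.2 hi)
  have hnorm : |s i * ((b q).1 i : ℝ) - s i * ((b q').1 i : ℝ)| ≤ gNorm s (b q - b q') := by
    simpa [mul_sub] using abs_mul_le_gNorm s (b q - b q') i
  have hq := abs_sub_le (t i * q i) (s i * ((b q).1 i : ℝ)) (t i * q' i)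
  have hq' := abs_sub_le (s i * ((b q).1 i : ℝ)) (s i * ((b q').1 i : ℝ)) (t i * q' i)
  rw [abs_sub_comm (t i * q i) (s i * ((b q).1 i : ℝ))] at hq
  linarith [hb q i, hb q' i, ht i]

variable [∀ k, NeZero (n k)]

theorem tendsto_card_finPreimage_boxFinset_div (hs : ∀ i, 0 < s i)
    {b : (Fin d → ℤ) → RefGroup d e n} {t : Fin d → ℝ} (ht : ∀ i, 0 < t i) {M : ℝ}
    (hb : ∀ q i, |s i * ((b q).1 i : ℝ) - t i * q i| ≤ M / 2) (hfin : ∀ g, (b ⁻¹' {g}).Finite) :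
    Tendsto (fun p : ℕ × RefGroup d e n =>
        ((finPreimage hfin (boxFinset hs p.1 p.2)).card : ℝ) / (boxFinset hs p.1 p.2).card)
      (uniformAtTop (RefGroup d e n)) (𝓝 ((∏ i, (t i)⁻¹) / boxConstant s n)) := by
  have hlattice (u : ℝ) := tendsto_card_latticeBox_div ht u
    fun (c : RefGroup d e n) i => s i * (c.1 i : ℝ)
  refine tendsto_div_card_boxFinset hs <| tendsto_of_tendsto_of_tendsto_of_le_of_le'
    (hlattice (-M)) (hlattice M) ?_ (Eventually.of_forall fun p => ?_)
  · filter_upwards [eventually_uniformAtTop_fst (eventually_ge_atTop 2)] with p hp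
    gcongr
    intro q hq
    rw [mem_latticeBox ht] at hq
    rw [mem_finPreimage, mem_boxFinset, mem_box_iff hp]
    intro i
    linarith [abs_sub_le (s i * ((b q).1 i : ℝ)) (t i * q i) (s i * p.2.1 i), hb q i, hq i]
  · gcongr
    intro q hq
    rw [mem_finPreimage, mem_boxFinset] at hq
    rw [mem_latticeBox ht]
    intro i
    have h := abs_sub_le (t i * q i) (s i * ((b q).1 i : ℝ)) (s i * p.2.1 i)
    rw [abs_sub_comm (t i * q i) (s i * ((b q).1 i : ℝ))] at h
    linarith [hb q i, abs_sub_le_of_mem_box hq i]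

theorem upperDensity_eq_lowerDensity_and_pos_of_abs_sub_le (hs : ∀ i, 0 < s i)
    {b : (Fin d → ℤ) → RefGroup d e n} {t : Fin d → ℝ} (ht : ∀ i, 0 < t i) {M : ℝ}
    (hb : ∀ q i, |s i * ((b q).1 i : ℝ) - t i * q i| ≤ M / 2) :
    upperDensity s b = lowerDensity s b ∧ 0 < lowerDensity s b := by
  have hfin : ∀ g, (b ⁻¹' {g}).Finite := fun g => by
    refine (latticeBox t (fun i => s i * (g.1 i : ℝ)) (M / 2)).finite_toSet.subset ?_
    rintro q rfl
    rw [Finset.mem_coe, mem_latticeBox ht]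
    exact fun i => (abs_sub_comm _ _).trans_le (hb q i)
  have h := (ENNReal.continuous_ofReal.tendsto _).comp
    (tendsto_card_finPreimage_boxFinset_div hs ht hb hfin)
  have hlow := (lowerDensity_eq_liminf hs hfin).trans h.liminf_eq
  have hup := (upperDensity_eq_limsup hs hfin).trans h.limsup_eq
  refine ⟨hup.trans hlow.symm, hlow ▸ ENNReal.ofReal_pos.2 ?_⟩
  exact div_pos (Finset.prod_pos fun i _ => inv_pos.2 (ht i)) (boxConstant_pos hs)

theorem exists_separated_subset (hs : ∀ i, 0 < s i) {J₀ : Set I} {M : ℕ}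
    (hJ₀ : ∀ c : RefGroup d e n, ∃ i ∈ J₀, a i ∈ box s M c) {R : ℝ} (hR : 0 ≤ R) :
    ∃ J ⊆ J₀, upperDensity s (fun i : J => a i) = lowerDensity s (fun i : J => a i) ∧
      0 < lowerDensity s (fun i : J => a i) ∧ J.Pairwise fun i j => R < gNorm s (a i - a j) := by
  obtain ⟨L, hL⟩ : ∃ L : ℕ, ∀ i, (R + M) / s i < L :=
    (eventually_all.2 fun i =>
      tendsto_natCast_atTop_atTop.eventually_gt_atTop ((R + M) / s i)).exists
  choose k hkJ hk using fun q : Fin d → ℤ => hJ₀ (fun i => (L : ℤ) * q i, 0)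
  have ht : ∀ i, R + M < s i * L := fun i => (div_lt_iff₀' (hs i)).1 (hL i)
  have hb : ∀ q i, |s i * ((a (k q)).1 i : ℝ) - s i * L * q i| ≤ (M : ℝ) / 2 := fun q i => by
    simpa [mul_assoc] using abs_sub_le_of_mem_box (hk q) i
  have hsep : ∀ q q', q ≠ q' → R < gNorm s (a (k q) - a (k q')) := fun q q' =>
    lt_gNorm_sub_of_abs_sub_le (b := a ∘ k) hb M.cast_nonneg hR ht
  have hk_inj : Function.Injective k := fun q q' hqq => by
    by_contra hne
    have h := hsep q q' hne
    rw [hqq, sub_self, gNorm_zero] at h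
    exact h.not_ge hR
  have hdens := upperDensity_eq_lowerDensity_and_pos_of_abs_sub_le hs (b := a ∘ k)
    (fun i => (by positivity : 0 ≤ R + M).trans_lt (ht i)) hb
  have hcomp : a ∘ k = (fun i : Set.range k => a i) ∘ Equiv.ofInjective k hk_inj := rfl
  rw [hcomp, upperDensity_comp_equiv, lowerDensity_comp_equiv] at hdens
  refine ⟨Set.range k, Set.range_subset_iff.2 hkJ, hdens.1, hdens.2, ?_⟩
  rintro _ ⟨q, rfl⟩ _ ⟨q', rfl⟩ hne
  exact hsep q q' (ne_of_apply_ne k hne)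

end SparseSubset

section Removal

variable {𝕜 : Type*} [RCLike 𝕜] {H : Type*} [NormedAddCommGroup H] [InnerProductSpace 𝕜 H]
  [CompleteSpace H] {d e : ℕ} {n : Fin e → ℕ} {I : Type*} {s : Fin d → ℝ}
  {a : I → RefGroup d e n} {f : I → H} {A B : ℝ}

theorem exists_sum_le_of_forall_lt {X : Type*} {r : X → ℝ} (hr : Summable r) (ρ : X → ℝ) {ε : ℝ}
    (hε : 0 < ε) : ∃ R, 0 ≤ R ∧ ∀ S : Finset X, (∀ x ∈ S, R < ρ x) → ∑ x ∈ S, r x ≤ ε := by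
  obtain ⟨T, hT⟩ := summable_iff_vanishing_norm.1 hr ε hε
  obtain ⟨R, hR⟩ := (T.image ρ).bddAbove
  refine ⟨max R 0, le_max_right _ _, fun S hS => ?_⟩
  have hdisj : Disjoint S T := Finset.disjoint_left.2 fun x hxS hxT =>
    ((le_max_left R 0).trans_lt (hS x hxS)).not_ge (hR (Finset.mem_image_of_mem ρ hxT))
  exact (le_abs_self _).trans (hT S hdisj).le

theorem IsL1LocalizedDual.exists_sum_norm_inner_le (hloc : IsL1LocalizedDual 𝕜 a f)
    (hf : IsFrameForWith 𝕜 ⊤ f A B) (s : Fin d → ℝ) {ε : ℝ} (hε : 0 < ε) :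
    ∃ R, 0 ≤ R ∧ ∀ J : Set I, (J.Pairwise fun i j => R < gNorm s (a i - a j)) →
      ∀ F : Finset I, ↑F ⊆ J → ∀ i ∈ F,
        ∑ j ∈ F, ‖inner 𝕜 (canonicalDual 𝕜 f j) (f i)‖ ≤ dualDiag 𝕜 f i + ε := by
  classical
  obtain ⟨r, hr, hfr⟩ := hloc
  obtain ⟨R, hR, hsum⟩ := exists_sum_le_of_forall_lt hr (gNorm s) hε
  refine ⟨R, hR, fun J hJ F hF i hi => ?_⟩
  have hinj : Set.InjOn (fun j => a i - a j) (F.erase i) := fun j hj j' hj' hjj => by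
    by_contra hne
    have h : R < gNorm s (a j - a j') :=
      hJ (hF (Finset.mem_of_mem_erase hj)) (hF (Finset.mem_of_mem_erase hj')) hne
    rw [sub_right_injective hjj, sub_self, gNorm_zero] at h
    exact h.not_ge hR
  rw [← Finset.add_sum_erase F _ hi, hf.norm_inner_canonicalDual_self]
  gcongr
  calc ∑ j ∈ F.erase i, ‖inner 𝕜 (canonicalDual 𝕜 f j) (f i)‖
      ≤ ∑ j ∈ F.erase i, r (a i - a j) := Finset.sum_le_sum fun j _ => hfr i j
    _ = ∑ g ∈ (F.erase i).image fun j => a i - a j, r g := (Finset.sum_image hinj).symm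
    _ ≤ ε := hsum _ <| Finset.forall_mem_image.2 fun j hj =>
        hJ (hF hi) (hF (Finset.mem_of_mem_erase hj)) (Finset.ne_of_mem_erase hj).symm

theorem exists_removable_subset [∀ k, NeZero (n k)] (hs : ∀ i, 0 < s i)
    (hf : IsFrameForWith 𝕜 ⊤ f A B) (hlow : 0 < lowerDensity s a) (hup : upperDensity s a < ⊤)
    (hloc : IsL1LocalizedDual 𝕜 a f) {α ε : ℝ} (h : upperMeasure 𝕜 s a f < ENNReal.ofReal α)
    (hε : 0 < ε) (hεα : ε < 1 - α) :
    ∃ J : Set I, J ⊆ {i | dualDiag 𝕜 f i ≤ α} ∧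
      upperDensity s (fun i : J => a i) = lowerDensity s (fun i : J => a i) ∧
      0 < lowerDensity s (fun i : J => a i) ∧
      IsFrameForWith 𝕜 (closedSpan 𝕜 f) (fun i : (Jᶜ : Set I) => f i) (A * (1 - α - ε)) B := by
  have hα : 0 < α := ENNReal.ofReal_pos.1 (bot_le.trans_lt h)
  obtain ⟨M, hM⟩ := exists_forall_exists_dualDiag_le_mem_box hs hf hlow hup h
  obtain ⟨R, hR, hrow⟩ := hloc.exists_sum_norm_inner_le hf s hε
  obtain ⟨J, hJα, heq, hpos, hsep⟩ := exists_separated_subset hs hM hR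
  refine ⟨J, hJα, heq, hpos, ?_⟩
  rw [hf.closedSpan_eq_top, sub_sub]
  refine hf.compl_of_sum_norm_inner_canonicalDual_le (add_pos hα hε).le (by linarith)
    fun F hF i hi => (hrow J hsep F hF i hi).trans ?_
  gcongr
  exact hJα (hF hi)

end Removal

end FrameDensity

theorem corollary3p8 {𝕜 : Type*} [RCLike 𝕜] {H : Type*} [NormedAddCommGroup H]
    [InnerProductSpace 𝕜 H] [CompleteSpace H] {I : Type*}
    {d e : ℕ} (hd : 0 < d) {n : Fin e → ℕ} (hn : ∀ k, 0 < n k)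
    (s : Fin d → ℝ) (hs : ∀ i, 0 < s i)
    (a : I → FrameDensity.RefGroup d e n)
    (f : I → H) (E : FrameDensity.RefGroup d e n → H) (A B : ℝ)
    (hf : FrameDensity.IsFrameForWith 𝕜 ⊤ f A B)
    (hE : FrameDensity.IsFrameFor 𝕜 ⊤ E)
    (hDlow : 0 < FrameDensity.lowerDensity s a)
    (hDup : FrameDensity.upperDensity s a < ⊤)
    (hloc : FrameDensity.IsL1LocalizedDual 𝕜 a f)
    (hcol : FrameDensity.HasL2ColumnDecay 𝕜 s a f E)
    (hrow : FrameDensity.HasL2RowDecay 𝕜 s a f E) :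
    -- for a Riesz basis `E`, the hypothesis `M⁺(E) < D⁻(I, a)` reads `D⁻(I, a) > 1`
    (FrameDensity.IsRieszBasis 𝕜 E →
      (FrameDensity.upperMeasure 𝕜 s id E < FrameDensity.lowerDensity s a ↔
        1 < FrameDensity.lowerDensity s a)) ∧
    (FrameDensity.upperMeasure 𝕜 s id E < FrameDensity.lowerDensity s a →
      FrameDensity.upperMeasure 𝕜 s a f < 1 ∧
      (∃ J : Set I,
        FrameDensity.upperDensity s (fun i : J => a i) =
          FrameDensity.lowerDensity s (fun i : J => a i) ∧
        0 < FrameDensity.lowerDensity s (fun i : J => a i) ∧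
        FrameDensity.IsFrameFor 𝕜 (FrameDensity.closedSpan 𝕜 f)
          (fun i : (Jᶜ : Set I) => f i)) ∧
      (∀ α : ℝ, FrameDensity.upperMeasure 𝕜 s a f < ENNReal.ofReal α → α < 1 →
        ∀ ε : ℝ, 0 < ε → ε < 1 - α →
          ∃ J : Set I, J ⊆ {i | FrameDensity.dualDiag 𝕜 f i ≤ α} ∧
            FrameDensity.upperDensity s (fun i : J => a i) =
              FrameDensity.lowerDensity s (fun i : J => a i) ∧
            0 < FrameDensity.lowerDensity s (fun i : J => a i) ∧
            FrameDensity.IsFrameForWith 𝕜 (FrameDensity.closedSpan 𝕜 f)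
              (fun i : (Jᶜ : Set I) => f i) (A * (1 - α - ε)) B)) := by
  have : ∀ k, NeZero (n k) := fun k => ⟨(hn k).ne'⟩
  obtain ⟨A', B', hE⟩ := hE
  refine ⟨fun hR => by rw [hR.upperMeasure_eq_one hs hE], fun h => ?_⟩
  have hlt := FrameDensity.upperMeasure_lt_one hs hf hE hDup hcol hrow h
  refine ⟨hlt, ?_, fun α hα _ ε hε hεα =>
    FrameDensity.exists_removable_subset hs hf hDlow hDup hloc hα hε hεα⟩
  obtain ⟨α, hα, hα₁⟩ := ENNReal.lt_iff_exists_nnreal_btwn.1 hlt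
  rw [← ENNReal.ofReal_coe_nnreal] at hα
  have hα₁' : (α : ℝ) < 1 := by exact_mod_cast hα₁
  obtain ⟨J, -, heq, hpos, hJ⟩ := FrameDensity.exists_removable_subset hs hf hDlow hDup hloc hα
    (ε := (1 - α) / 2) (by linarith) (by linarith)
  exact ⟨J, heq, hpos, _, _, hJ⟩
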